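/- For graphs $B$ (the board) and $H$ (the target), in the strong Ramsey game $\mathcal{R}(B,H)$ two players, P1 and P2, alternately claim a previously unclaimed edge of $B$, with P1 moving first. The first player whose claimed edges contain a (not necessarily induced) isomorphic copy of $H$ wins, and the game stops; if this does not happen after finitely many moves, no player wins. The game is called a draw if each player has a strategy that guarantees that the opponent does not win. **Theorem.** Let $K_\omega$ be the complete graph on a countably infinite vertex set, and let $G=K_6\setminus K_4$ be the graph with vertices $A_0,A_1,B_1,B_2,B_3,B_4$ whose nine edges are $A_0A_1$ and $A_0B_i$, $A_1B_i$ for $1\le i\le 4$. Then the strong Ramsey game $\mathcal{R}(K_\omega\sqcup K_\omega,G)$, played on the disjoint union of two copies of $K_\omega$, is a draw. -/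

import Mathlib

namespace RamseyGame

/-- The two players of the game. -/
inductive Player
  | P1
  | P2

namespace Player

/-- The opponent of a player. -/
def opponent : Player → Player
  | P1 => P2
  | P2 => P1

/-- The player who makes the `i`-th move (counting from `0`): the players alternate,
starting with `P1`. -/
def mover (i : ℕ) : Player :=
  if Even i then P1 else P2

end Player

open scoped SimpleGraph

variable {V W : Type*}

/-- The edges claimed by the player `p` when `h` is the list of all edges claimed so far,
in chronological order. -/
def claimed (p : Player) (h : List (Sym2 V)) : Set (Sym2 V) :=
  {e | ∃ i : ℕ, h[i]? = some e ∧ Player.mover i = p}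

/-- The edges claimed by the player `p` contain a (not necessarily induced) isomorphic copy
of the target graph `H`. -/
def HasCopy (H : SimpleGraph W) (p : Player) (h : List (Sym2 V)) : Prop :=
  H ⊑ SimpleGraph.fromEdgeSet (claimed p h)

/-- After the history `h`, claiming the edge `e` is a legal move of the strong Ramsey game with
board `B` and target `H`: no player has completed a copy of `H` yet, and `e` is a previously
unclaimed edge of `B`. -/
def IsMove (B : SimpleGraph V) (H : SimpleGraph W) (h : List (Sym2 V)) (e : Sym2 V) : Prop :=
  (∀ p : Player, ¬ HasCopy H p h) ∧ e ∈ B.edgeSet ∧ e ∉ h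

/-- A strategy chooses a legal move after every history after which there is one. -/
def Strategy (B : SimpleGraph V) (H : SimpleGraph W) : Type _ :=
  (h : List (Sym2 V)) → (∃ e, IsMove B H h e) → {e : Sym2 V // IsMove B H h e}

/-- The histories that can arise in the strong Ramsey game with board `B` and target `H` when
the player `p` follows the strategy `σ` and the opponent makes arbitrary legal moves. -/
inductive Reachable (B : SimpleGraph V) (H : SimpleGraph W) (p : Player) (σ : Strategy B H) :
    List (Sym2 V) → Prop
  | start : Reachable B H p σ []
  | own (h : List (Sym2 V)) (hex : ∃ e, IsMove B H h e) :
      Reachable B H p σ h → Player.mover h.length = p →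
      Reachable B H p σ (h ++ [(σ h hex).1])
  | opp (h : List (Sym2 V)) (e : Sym2 V) :
      Reachable B H p σ h → Player.mover h.length = p.opponent → IsMove B H h e →
      Reachable B H p σ (h ++ [e])

/-- `σ` is a drawing (that is, non-losing) strategy for the player `p`: if `p` follows it, then
at no (finite) time has the opponent won, whatever the opponent plays. Since the game stops as
soon as some player completes a copy of `H`, the opponent has won exactly when a history
is reached in which the opponent owns a copy. -/
def IsDrawingStrategy (B : SimpleGraph V) (H : SimpleGraph W) (p : Player)
    (σ : Strategy B H) : Prop :=
  ∀ h, Reachable B H p σ h → ¬ HasCopy H p.opponent h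

/-- The strong Ramsey game with board `B` and target `H` is a draw: each of the two players has
a strategy that prevents the other one from winning. -/
def IsDraw (B : SimpleGraph V) (H : SimpleGraph W) : Prop :=
  ∀ p : Player, ∃ σ : Strategy B H, IsDrawingStrategy B H p σ

end RamseyGame

/-- The graph `K₆ \ K₄`: the complete graph on `{0, …, 5}` with all edges between the four
vertices `2, 3, 4, 5` removed. -/
def K6MinusK4 : SimpleGraph (Fin 6) where
  Adj u v := u ≠ v ∧ (u < 2 ∨ v < 2)
  symm := ⟨fun _ _ h => ⟨h.1.symm, h.2.symm⟩⟩
  loopless := ⟨fun _ h => h.1 rfl⟩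

/-- The graph `K_ω`: the complete graph on a countably infinite vertex set. -/
def Komega : SimpleGraph ℕ := ⊤

/-! The target is a book: four triangles (pages) on a common edge (the spine), nine edges in all. A
draw needs one non-losing strategy for each player.

For P1 this is strategy stealing (`not_loses_empty`): extra edges never hurt (`Loses.mono`), and the
two players cannot both be lost (`Loses.not_wins`).

For P2, the defender, the second copy of `K_ω` is essential. The defender opens in the copy that
P1's first edge avoids, so that edge is useless there, and aims for two triangles on a common spine
`st`. After that the defender need not win: a draw follows by forcing forever. If three pages are
owned, claiming `ty` for a fresh vertex `y` threatens to complete the book with `sy`; the opponent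
must answer `sy`, and the move is repeated with a new vertex. The opponent thereby gains nothing but
a star at `s`. With two pages the same move only threatens a third page, so ignoring it gives the
opponent two free edges. Hence two pages suffice if no book still available to the opponent contains
more than five of the opponent's edges, even after arbitrary star edges at `s` are added
(`StarBound`, `draws_of_two_pages`).

Star edges can spoil this bound only if the opponent has a triangle or a four-cycle at `s`
(`starBound_of_not_dangerous`). Either end of the spine may play the role of `s`, so the opponent
would need such a configuration at both ends (`draws_of_spine`), and counting edges shows that there
are too few. If the opponent spends all six moves in the other copy, the count of five may fail.
Then `draws_of_race` blocks the one dangerous book, after which each new threat can be met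
(`draws_of_contained`). The opening analysis, ending in `draws_of_first_move`, reaches a suitable
pair of triangles whatever P1 does. -/

namespace RamseyGame

/-! ### Lost positions, monotonicity and strategy stealing -/

section General

variable {V W : Type*}

/-- The edge set `X` contains a copy of `H`. -/
def Contains (H : SimpleGraph W) (X : Finset (Sym2 V)) : Prop :=
  H.IsContained (SimpleGraph.fromEdgeSet (X : Set (Sym2 V)))

lemma Contains.mono {H : SimpleGraph W} {X Y : Finset (Sym2 V)} (h : Contains H X)
    (hXY : X ⊆ Y) : Contains H Y :=
  SimpleGraph.IsContained.mono_right h (SimpleGraph.fromEdgeSet_mono (by exact_mod_cast hXY))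

variable [DecidableEq V]

/-- `e` is an edge of the board that is in neither `X` nor `Y`. -/
def Free (B : SimpleGraph V) (X Y : Finset (Sym2 V)) (e : Sym2 V) : Prop :=
  e ∈ B.edgeSet ∧ e ∉ X ∧ e ∉ Y

/-- The player to move, who owns `X`, loses against the opponent, who owns `Y`. -/
inductive Loses (B : SimpleGraph V) (H : SimpleGraph W) :
    Finset (Sym2 V) → Finset (Sym2 V) → Prop
  | lost (X Y : Finset (Sym2 V)) : Contains H Y → Loses B H X Y
  | step (X Y : Finset (Sym2 V)) (g : Sym2 V → Sym2 V) :
      (∀ e, Free B X Y e → ¬ Contains H (insert e X)) →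
      (∀ e, Free B X Y e → Free B (insert e X) Y (g e)) →
      (∀ e, Free B X Y e → Loses B H (insert e X) (insert (g e) Y)) → Loses B H X Y

variable {B : SimpleGraph V} {H : SimpleGraph W}

/-- `Loses` is inductive, so a loss is reached in finitely many moves along each line of play. A
property that the mover can restore forever excludes it. The last alternative permits leaving the
invariant for a position already known not to be lost. -/
lemma not_loses_of_invariant (I : Finset (Sym2 V) → Finset (Sym2 V) → Prop)
    (hI : ∀ X Y, I X Y → ¬ Contains H Y ∧ ∃ e, Free B X Y e ∧ (Contains H (insert e X) ∨
      ∀ f, Free B (insert e X) Y f → I (insert e X) (insert f Y) ∨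
        ¬ Loses B H (insert e X) (insert f Y)))
    {X Y : Finset (Sym2 V)} (h : I X Y) : ¬ Loses B H X Y := by
  intro hL
  induction hL with
  | lost X Y hc => exact (hI X Y h).1 hc
  | step X Y g h1 h2 h3 ih =>
    obtain ⟨_, e, he, h'⟩ := hI X Y h
    rcases h' with h' | h'
    · exact h1 e he h'
    · rcases h' (g e) (h2 e he) with h4 | h4
      · exact ih e he h4
      · exact h4 (h3 e he)

lemma exists_move_of_not_loses {X Y : Finset (Sym2 V)} (h : ¬ Loses B H X Y) :
    ¬ Contains H Y ∧ ∃ e, Free B X Y e ∧ (Contains H (insert e X) ∨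
      ∀ f, Free B (insert e X) Y f → ¬ Loses B H (insert e X) (insert f Y)) := by
  refine ⟨fun hc => h (.lost X Y hc), ?_⟩
  by_contra hcon
  push Not at hcon
  apply h
  choose! g hg using fun e he => (hcon e he).2
  exact .step X Y g (fun e he => (hcon e he).1) (fun e he => (hg e he).1)
    (fun e he => (hg e he).2)

lemma exists_free (hB : B.edgeSet.Infinite) (X Y : Finset (Sym2 V)) : ∃ e, Free B X Y e := by
  obtain ⟨e, he, hn⟩ := hB.exists_notMem_finset (X ∪ Y)
  simp only [Finset.mem_union, not_or] at hn
  exact ⟨e, he, hn⟩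

lemma Loses.mono (hB : B.edgeSet.Infinite) {X Y : Finset (Sym2 V)} (h : Loses B H X Y) :
    ∀ Y', Y ⊆ Y' → Loses B H X Y' := by
  induction h with
  | lost X Y hc => exact fun Y' hY => .lost _ _ (hc.mono hY)
  | step X Y g h1 h2 h3 ih =>
    intro Y' hY
    have hf : ∀ e, Free B X Y' e → Free B X Y e := fun e he =>
      ⟨he.1, he.2.1, fun h => he.2.2 (hY h)⟩
    -- When the planned reply is already owned in `Y'`, any free edge is played instead; it only
    -- enlarges the opponent's set.
    choose g' hg' using fun e => exists_free hB (insert e X) Y'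
    refine .step X Y' (fun e => if g e ∈ Y' then g' e else g e) (fun e he => h1 e (hf e he))
      (fun e he => ?_) (fun e he => ?_)
    · split_ifs with hgy
      · exact hg' e
      · exact ⟨(h2 e (hf e he)).1, (h2 e (hf e he)).2.1, hgy⟩
    · refine ih e (hf e he) _ ?_
      split_ifs with hgy
      · intro x hx
        rcases Finset.mem_insert.1 hx with rfl | hx
        · exact Finset.mem_insert_of_mem hgy
        · exact Finset.mem_insert_of_mem (hY hx)
      · exact Finset.insert_subset_insert _ hY

/-- Both players cannot be lost: each of the two assumptions supplies replies, and letting these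
replies answer each other descends along the derivation. -/
lemma Loses.not_wins {X Y : Finset (Sym2 V)} (h : Loses B H X Y) :
    ¬ Contains H Y → ∀ f, Free B X Y f → ¬ Loses B H Y (insert f X) := by
  induction h with
  | lost X Y hc => exact fun hn => absurd hc hn
  | step X Y g h1 h2 h3 ih =>
    intro hY f hf hL
    cases hL with
    | lost _ _ hc => exact h1 f hf hc
    | step _ _ k k1 k2 k3 =>
      have hg := h2 f hf
      have hg' : Free B Y (insert f X) (g f) := ⟨hg.1, hg.2.2, hg.2.1⟩
      have hk := k2 _ hg'
      exact ih f hf (k1 _ hg') _ ⟨hk.1, hk.2.2, hk.2.1⟩ (k3 _ hg')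

/-- Strategy stealing. -/
lemma not_loses_empty (hB : B.edgeSet.Infinite) (hH : ¬ Contains H (∅ : Finset (Sym2 V))) :
    ¬ Loses B H ∅ ∅ := by
  intro h
  obtain ⟨e, he⟩ := exists_free hB ∅ ∅
  -- If moving first on the empty board loses, then so does moving next when the opponent already
  -- owns `e`. But this is the position of the second player after the first move `e`, so both
  -- players would be lost.
  have h1 : Loses B H ∅ {e} := h.mono hB _ (by simp)
  refine Loses.not_wins h hH e he ?_
  simpa using h1

end General

/-! ### From lost positions to strategies on histories -/

section Strategy

variable {V W : Type*}

lemma mem_of_mem_claimed {p : Player} {h : List (Sym2 V)} {e : Sym2 V} (he : e ∈ claimed p h) :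
    e ∈ h := by
  obtain ⟨i, hi, _⟩ := he
  exact List.mem_of_getElem? hi

lemma mem_claimed_append {p : Player} {h : List (Sym2 V)} {e x : Sym2 V} :
    x ∈ claimed p (h ++ [e]) ↔ x ∈ claimed p h ∨ (x = e ∧ Player.mover h.length = p) := by
  constructor
  · rintro ⟨i, hi, hp⟩
    rcases lt_trichotomy i h.length with hl | hl | hl
    · rw [List.getElem?_append_left hl] at hi
      exact .inl ⟨i, hi, hp⟩
    · subst hl
      rw [List.getElem?_append_right le_rfl] at hi
      simp at hi
      exact .inr ⟨hi.symm, hp⟩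
    · rw [List.getElem?_eq_none (by simp; omega)] at hi
      simp at hi
  · rintro (⟨i, hi, hp⟩ | ⟨rfl, hp⟩)
    · refine ⟨i, ?_, hp⟩
      have hl := (List.getElem?_eq_some_iff.1 hi).1
      rw [List.getElem?_append_left hl]
      exact hi
    · exact ⟨h.length, by simp, hp⟩

lemma mem_claimed_or {h : List (Sym2 V)} {e : Sym2 V} (he : e ∈ h) (p : Player) :
    e ∈ claimed p h ∨ e ∈ claimed p.opponent h := by
  obtain ⟨i, hi⟩ := List.mem_iff_getElem?.1 he
  by_cases hp : Player.mover i = p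
  · exact .inl ⟨i, hi, hp⟩
  · refine .inr ⟨i, hi, ?_⟩
    generalize Player.mover i = q at hp
    cases p <;> cases q <;> simp_all [Player.opponent]

lemma mover_append {h : List (Sym2 V)} {e : Sym2 V} :
    Player.mover (h ++ [e]).length = (Player.mover h.length).opponent := by
  simp only [List.length_append, List.length_singleton, Player.mover, Nat.even_add_one]
  split_ifs <;> simp_all [Player.opponent]

variable [DecidableEq V]

open Classical in
/-- The edges of `p` after the history `h`, as a finset. -/
noncomputable def owned (p : Player) (h : List (Sym2 V)) : Finset (Sym2 V) :=
  h.toFinset.filter (· ∈ claimed p h)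

lemma coe_owned (p : Player) (h : List (Sym2 V)) : (owned p h : Set (Sym2 V)) = claimed p h := by
  ext x
  simp only [owned, Finset.coe_filter, List.mem_toFinset, Set.mem_ofPred_eq]
  exact ⟨fun h => h.2, fun h => ⟨mem_of_mem_claimed h, h⟩⟩

lemma mem_owned {p : Player} {h : List (Sym2 V)} {x : Sym2 V} :
    x ∈ owned p h ↔ x ∈ claimed p h := by
  rw [← Finset.mem_coe, coe_owned]

lemma contains_owned {H : SimpleGraph W} {p : Player} {h : List (Sym2 V)} :
    Contains H (owned p h) ↔ HasCopy H p h := by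
  rw [Contains, coe_owned, HasCopy]

lemma owned_append_self {p : Player} {h : List (Sym2 V)} {e : Sym2 V}
    (hp : Player.mover h.length = p) : owned p (h ++ [e]) = insert e (owned p h) := by
  ext x
  simp only [mem_owned, mem_claimed_append, Finset.mem_insert]
  tauto

lemma owned_append_other {p : Player} {h : List (Sym2 V)} {e : Sym2 V}
    (hp : Player.mover h.length ≠ p) : owned p (h ++ [e]) = owned p h := by
  ext x
  simp only [mem_owned, mem_claimed_append]
  tauto

lemma opponent_ne (p : Player) : p.opponent ≠ p := by cases p <;> simp [Player.opponent]

lemma opponent_opponent (p : Player) : p.opponent.opponent = p := by cases p <;> rfl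

variable {B : SimpleGraph V} {H : SimpleGraph W}

lemma isMove_free {p : Player} {h : List (Sym2 V)} {e : Sym2 V} (he : IsMove B H h e) :
    Free B (owned p h) (owned p.opponent h) e :=
  ⟨he.2.1, fun hx => he.2.2 (mem_of_mem_claimed (mem_owned.1 hx)),
    fun hx => he.2.2 (mem_of_mem_claimed (mem_owned.1 hx))⟩

lemma free_isMove {p : Player} {h : List (Sym2 V)} {e : Sym2 V}
    (he : Free B (owned p h) (owned p.opponent h) e) (h1 : ¬ HasCopy H p h)
    (h2 : ¬ HasCopy H p.opponent h) : IsMove B H h e := by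
  refine ⟨fun q => ?_, he.1, fun hx => ?_⟩
  · by_cases hq : q = p
    · exact hq ▸ h1
    · have : q = p.opponent := by cases p <;> cases q <;> simp_all [Player.opponent]
      exact this ▸ h2
  · rcases mem_claimed_or hx p with hx | hx
    · exact he.2.1 (mem_owned.2 hx)
    · exact he.2.2 (mem_owned.2 hx)

lemma exists_drawing_strategy (p : Player) (hH : ¬ Contains H (∅ : Finset (Sym2 V)))
    (h1 : p = .P1 → ¬ Loses B H ∅ ∅)
    (h2 : p = .P2 → ∀ e ∈ B.edgeSet, ¬ Loses B H ∅ {e}) :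
    ∃ σ : Strategy B H, IsDrawingStrategy B H p σ := by
  classical
  let good : List (Sym2 V) → Sym2 V → Prop := fun h e => IsMove B H h e ∧
    (Contains H (insert e (owned p h)) ∨ ∀ f,
      Free B (insert e (owned p h)) (owned p.opponent h) f →
        ¬ Loses B H (insert e (owned p h)) (insert f (owned p.opponent h)))
  let σ : Strategy B H := fun h hex =>
    if hg : ∃ e, good h e then ⟨hg.choose, hg.choose_spec.1⟩ else ⟨hex.choose, hex.choose_spec⟩
  have hσ : ∀ h hex, (∃ e, good h e) → good h (σ h hex).1 := by
    intro h hex hg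
    simp only [σ, dif_pos hg]
    exact hg.choose_spec
  refine ⟨σ, fun h hr => ?_⟩
  -- The induction needs a statement for either turn: when `p` moves, the position is not lost; when
  -- the opponent moves, no reply makes it lost, unless `p` has already won.
  suffices hs : ¬ HasCopy H p.opponent h ∧
      (Player.mover h.length = p →
        ¬ Loses B H (owned p h) (owned p.opponent h)) ∧
      (Player.mover h.length = p.opponent → HasCopy H p h ∨ ∀ f,
        Free B (owned p h) (owned p.opponent h) f →
          ¬ Loses B H (owned p h) (insert f (owned p.opponent h))) from hs.1
  have hne := opponent_ne p
  induction hr with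
  | start =>
    have ho : ∀ q, owned q ([] : List (Sym2 V)) = ∅ := fun q => by simp [owned]
    refine ⟨by rwa [← contains_owned, ho], fun hp => ?_, fun hp => .inr fun f hf => ?_⟩
    · rw [ho, ho]
      exact h1 (by rw [← hp]; rfl)
    · rw [ho, ho]
      refine h2 ?_ f hf.1
      rw [← opponent_opponent p, ← hp]; rfl
  | own h hex hr hm ih =>
    obtain ⟨ih1, ih2, -⟩ := ih
    obtain ⟨-, e, he, he'⟩ := exists_move_of_not_loses (ih2 hm)
    obtain ⟨e0, he0⟩ := hex
    have hg := hσ h ⟨e0, he0⟩ ⟨e, free_isMove he (he0.1 p) ih1, he'⟩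
    set x := (σ h ⟨e0, he0⟩).1
    have hm' : Player.mover h.length ≠ p.opponent := by rw [hm]; exact hne.symm
    rw [← contains_owned, ← contains_owned, owned_append_self hm, owned_append_other hm',
      mover_append, hm]
    exact ⟨fun hc => ih1 (contains_owned.1 hc), fun hc => absurd hc hne, fun _ => hg.2⟩
  | opp h e hr hm he ih =>
    obtain ⟨ih1, -, ih2⟩ := ih
    have hL := (ih2 hm).resolve_left (he.1 p) e (isMove_free he)
    have hm' : Player.mover h.length ≠ p := by rw [hm]; exact hne
    rw [← contains_owned, ← contains_owned, owned_append_self hm, owned_append_other hm',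
      mover_append, hm, opponent_opponent]
    exact ⟨(exists_move_of_not_loses hL).1, fun _ => hL, fun hc => absurd hc hne.symm⟩

theorem isDraw_of_not_loses (hB : B.edgeSet.Infinite) (hH : ¬ Contains H (∅ : Finset (Sym2 V)))
    (h2 : ∀ e ∈ B.edgeSet, ¬ Loses B H ∅ {e}) : IsDraw B H :=
  fun p => exists_drawing_strategy p hH (fun _ => not_loses_empty hB hH) fun _ => h2

end Strategy

/-! ### The board, books and live books -/

/-- The disjoint union of two copies of `K_ω`. -/
abbrev Board : SimpleGraph (ℕ ⊕ ℕ) := Komega ⊕g Komega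

/-- The copy of `K_ω` in which a vertex lies. -/
def side (x : ℕ ⊕ ℕ) : Bool := x.isLeft

lemma mem_board {x y : ℕ ⊕ ℕ} : s(x, y) ∈ Board.edgeSet ↔ x ≠ y ∧ side x = side y := by
  cases x <;> cases y <;> simp [Komega, side]

lemma board_infinite : Board.edgeSet.Infinite := by
  refine Set.infinite_of_injective_forall_mem (f := fun n : ℕ => s(.inl 0, .inl (n + 1))) ?_ ?_
  · intro m n h
    simpa using h
  · intro n
    simp [Komega]

/-- The edges of the book with spine `uv` and set of pages `P`. -/
def bookEdges (u v : ℕ ⊕ ℕ) (P : Finset (ℕ ⊕ ℕ)) : Finset (Sym2 (ℕ ⊕ ℕ)) :=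
  insert s(u, v) (P.image (fun p => s(u, p)) ∪ P.image (fun p => s(v, p)))

lemma mem_bookEdges {u v : ℕ ⊕ ℕ} {P : Finset (ℕ ⊕ ℕ)} {g : Sym2 (ℕ ⊕ ℕ)} :
    g ∈ bookEdges u v P ↔ g = s(u, v) ∨ (∃ p ∈ P, s(u, p) = g) ∨ ∃ p ∈ P, s(v, p) = g := by
  simp [bookEdges]

lemma bookEdges_comm (u v : ℕ ⊕ ℕ) (P : Finset (ℕ ⊕ ℕ)) : bookEdges u v P = bookEdges v u P := by
  ext g
  rw [mem_bookEdges, mem_bookEdges, Sym2.eq_swap]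
  exact or_congr_right or_comm

lemma spine_mem {u v : ℕ ⊕ ℕ} {P : Finset (ℕ ⊕ ℕ)} : s(u, v) ∈ bookEdges u v P :=
  mem_bookEdges.2 (.inl rfl)

lemma left_mem {u v p : ℕ ⊕ ℕ} {P : Finset (ℕ ⊕ ℕ)} (hp : p ∈ P) : s(u, p) ∈ bookEdges u v P :=
  mem_bookEdges.2 (.inr (.inl ⟨p, hp, rfl⟩))

lemma right_mem {u v p : ℕ ⊕ ℕ} {P : Finset (ℕ ⊕ ℕ)} (hp : p ∈ P) : s(v, p) ∈ bookEdges u v P :=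
  mem_bookEdges.2 (.inr (.inr ⟨p, hp, rfl⟩))

lemma bookEdges_subset {u v : ℕ ⊕ ℕ} {P : Finset (ℕ ⊕ ℕ)} {X : Finset (Sym2 (ℕ ⊕ ℕ))}
    (h0 : s(u, v) ∈ X) (h1 : ∀ p ∈ P, s(u, p) ∈ X) (h2 : ∀ p ∈ P, s(v, p) ∈ X) :
    bookEdges u v P ⊆ X := by
  intro g hg
  rcases mem_bookEdges.1 hg with rfl | ⟨p, hp, rfl⟩ | ⟨p, hp, rfl⟩
  exacts [h0, h1 p hp, h2 p hp]

lemma contains_of_bookEdges {u v : ℕ ⊕ ℕ} {P : Finset (ℕ ⊕ ℕ)} {X : Finset (Sym2 (ℕ ⊕ ℕ))}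
    (huv : u ≠ v) (hu : u ∉ P) (hv : v ∉ P) (hP : P.card = 4) (hX : bookEdges u v P ⊆ X) :
    Contains K6MinusK4 X := by
  have e := P.equivFinOfCardEq hP
  let q : Fin 4 → ℕ ⊕ ℕ := fun i => (e.symm i : ℕ ⊕ ℕ)
  have hq : ∀ i, q i ∈ P := fun i => (e.symm i).2
  have hqi : Function.Injective q := fun i j h => e.symm.injective (Subtype.ext h)
  let f : Fin 6 → ℕ ⊕ ℕ := Fin.cons u (Fin.cons v q)
  have hqu : ∀ i, q i ≠ u := fun i h => hu (h ▸ hq i)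
  have hqv : ∀ i, q i ≠ v := fun i h => hv (h ▸ hq i)
  have hfi : Function.Injective f := by
    refine Fin.cons_injective_iff.2 ⟨?_, Fin.cons_injective_iff.2 ⟨?_, hqi⟩⟩
    · rintro ⟨i, hi⟩
      induction i using Fin.cases with
      | zero => exact huv hi.symm
      | succ i => exact hqu i hi
    · rintro ⟨i, hi⟩
      exact hqv i hi
  have hE0 : ∀ i, i ≠ 0 → s(u, f i) ∈ X := by
    intro i hi
    fin_cases i
    exacts [absurd rfl hi, hX spine_mem, hX (left_mem (hq 0)), hX (left_mem (hq 1)),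
      hX (left_mem (hq 2)), hX (left_mem (hq 3))]
  have hE1 : ∀ i, i ≠ 1 → s(v, f i) ∈ X := by
    intro i hi
    fin_cases i
    exacts [Sym2.eq_swap ▸ hX spine_mem, absurd rfl hi, hX (right_mem (hq 0)),
      hX (right_mem (hq 1)), hX (right_mem (hq 2)), hX (right_mem (hq 3))]
  have hlt : ∀ i : Fin 6, i < 2 → i = 0 ∨ i = 1 := by decide
  have key : ∀ i j : Fin 6, i ≠ j → i < 2 → s(f i, f j) ∈ X := by
    intro i j hij hi
    rcases hlt i hi with rfl | rfl
    · exact hE0 j hij.symm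
    · exact hE1 j hij.symm
  refine ⟨⟨⟨f, fun {i j} hij => ?_⟩, hfi⟩⟩
  rw [SimpleGraph.fromEdgeSet_adj]
  refine ⟨?_, hfi.ne hij.1⟩
  rcases hij.2 with h | h
  · exact key i j hij.1 h
  · rw [Sym2.eq_swap]
    exact key j i hij.1.symm h

lemma exists_book_of_contains {X : Finset (Sym2 (ℕ ⊕ ℕ))} (h : Contains K6MinusK4 X) :
    ∃ u v P, u ≠ v ∧ u ∉ P ∧ v ∉ P ∧ P.card = 4 ∧ bookEdges u v P ⊆ X := by
  obtain ⟨⟨f, hf⟩⟩ := h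
  have hf' : Function.Injective f := hf
  have hadj : ∀ i j : Fin 6, i ≠ j → (i < 2 ∨ j < 2) → s(f i, f j) ∈ X := by
    intro i j hij h2
    have := f.map_rel (a := i) (b := j) ⟨hij, h2⟩
    exact_mod_cast ((SimpleGraph.fromEdgeSet_adj _).1 this).1
  let T : Finset (Fin 6) := {2, 3, 4, 5}
  refine ⟨f 0, f 1, T.image f, hf'.ne (by decide), ?_, ?_, ?_, ?_⟩
  · simp only [Finset.mem_image, hf'.eq_iff]
    decide
  · simp only [Finset.mem_image, hf'.eq_iff]
    decide
  · rw [Finset.card_image_of_injective _ hf']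
    rfl
  · refine bookEdges_subset (hadj 0 1 (by decide) (by decide)) ?_ ?_ <;>
    · simp only [Finset.mem_image]
      rintro p ⟨i, hi, rfl⟩
      refine hadj _ _ ?_ (.inl (by decide))
      revert i
      decide

/-- The book with spine `uv` and four pages `P` is a subgraph of the board that uses no edge
of `X`. -/
structure LiveBook (X : Finset (Sym2 (ℕ ⊕ ℕ))) (u v : ℕ ⊕ ℕ) (P : Finset (ℕ ⊕ ℕ)) : Prop where
  ne : u ≠ v
  left : u ∉ P
  right : v ∉ P
  card : P.card = 4
  board : ∀ g ∈ bookEdges u v P, g ∈ Board.edgeSet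
  free : ∀ g ∈ bookEdges u v P, g ∉ X

namespace LiveBook

variable {X X' : Finset (Sym2 (ℕ ⊕ ℕ))} {u v : ℕ ⊕ ℕ} {P : Finset (ℕ ⊕ ℕ)}

lemma symm (h : LiveBook X u v P) : LiveBook X v u P :=
  ⟨h.ne.symm, h.right, h.left, h.card, bookEdges_comm u v P ▸ h.board,
    bookEdges_comm u v P ▸ h.free⟩

lemma anti (h : LiveBook X' u v P) (hX : X ⊆ X') : LiveBook X u v P :=
  ⟨h.ne, h.left, h.right, h.card, h.board, fun g hg hx => h.free g hg (hX hx)⟩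

lemma side_page (h : LiveBook X u v P) {p : ℕ ⊕ ℕ} (hp : p ∈ P) : side p = side u :=
  (mem_board.1 (h.board _ (left_mem hp))).2.symm

lemma side_right (h : LiveBook X u v P) : side v = side u :=
  (mem_board.1 (h.board _ spine_mem)).2.symm

lemma mem_or_of_mem {g : Sym2 (ℕ ⊕ ℕ)} (hg : g ∈ bookEdges u v P) {x : ℕ ⊕ ℕ}
    (hx : x ∈ g) : x = u ∨ x = v ∨ x ∈ P := by
  rcases mem_bookEdges.1 hg with rfl | ⟨p, hp, rfl⟩ | ⟨p, hp, rfl⟩ <;>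
    rcases Sym2.mem_iff.1 hx with rfl | rfl <;> simp_all

lemma side_of_mem (h : LiveBook X u v P) {g : Sym2 (ℕ ⊕ ℕ)} (hg : g ∈ bookEdges u v P)
    {x : ℕ ⊕ ℕ} (hx : x ∈ g) : side x = side u := by
  rcases mem_or_of_mem hg hx with rfl | rfl | hp
  exacts [rfl, h.side_right, h.side_page hp]

lemma left_ne (h : LiveBook X u v P) {p : ℕ ⊕ ℕ} (hp : p ∈ P) : p ≠ u :=
  fun he => h.left (he ▸ hp)

lemma right_ne (h : LiveBook X u v P) {p : ℕ ⊕ ℕ} (hp : p ∈ P) : p ≠ v :=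
  fun he => h.right (he ▸ hp)

lemma card_bookEdges (h : LiveBook X u v P) : (bookEdges u v P).card = 9 := by
  rw [bookEdges, Finset.card_insert_of_notMem, Finset.card_union_of_disjoint,
    Finset.card_image_of_injective, Finset.card_image_of_injective, h.card]
  · exact fun a b hab => Sym2.congr_right.1 hab
  · exact fun a b hab => Sym2.congr_right.1 hab
  · rw [Finset.disjoint_left]
    simp only [Finset.mem_image, not_exists, not_and]
    rintro g ⟨p, hp, rfl⟩ q hq he
    rcases Sym2.eq_iff.1 he with ⟨h1, -⟩ | ⟨h1, h2⟩
    · exact h.ne h1.symm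
    · exact h.right (h1 ▸ hp)
  · simp only [Finset.mem_union, Finset.mem_image, not_or, not_exists, not_and]
    refine ⟨fun p hp he => ?_, fun p hp he => ?_⟩
    · rcases Sym2.eq_iff.1 he with ⟨-, h2⟩ | ⟨h1, h2⟩
      · exact h.right (h2 ▸ hp)
      · exact h.ne h1
    · rcases Sym2.eq_iff.1 he with ⟨h1, h2⟩ | ⟨h1, h2⟩
      · exact h.ne h1.symm
      · exact h.left (h2 ▸ hp)

lemma card_filter_mem_le (h : LiveBook X u v P) (x : ℕ ⊕ ℕ) :
    ((bookEdges u v P).filter (x ∈ ·)).card ≤ 5 := by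
  set W := insert u (insert v P) with hW
  have hWc : W.card = 6 := by
    rw [hW, Finset.card_insert_of_notMem, Finset.card_insert_of_notMem h.right, h.card]
    simp [h.ne, h.left]
  have hsub : ∀ g ∈ bookEdges u v P, ∀ y ∈ g, y ∈ W := by
    intro g hg y hy
    rcases mem_or_of_mem hg hy with rfl | rfl | hp <;> simp_all
  by_cases hx : x ∈ W
  · calc _ ≤ ((W.erase x).image (fun y => s(x, y))).card := by
          apply Finset.card_le_card
          intro g hg
          obtain ⟨hg, hxg⟩ := Finset.mem_filter.1 hg
          obtain ⟨y, rfl⟩ := hxg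
          refine Finset.mem_image.2 ⟨y, Finset.mem_erase.2 ⟨?_, hsub _ hg y (by simp)⟩, rfl⟩
          exact ((mem_board.1 (h.board _ hg)).1).symm
      _ ≤ (W.erase x).card := Finset.card_image_le
      _ = 5 := by rw [Finset.card_erase_of_mem hx, hWc]
  · rw [Finset.card_eq_zero.2]
    · omega
    · rw [Finset.filter_eq_empty_iff]
      exact fun g hg hxg => hx (hsub g hg x hxg)

end LiveBook

/-- `X` and `Y` are disjoint sets of edges of the board. -/
structure IsPosition (X Y : Finset (Sym2 (ℕ ⊕ ℕ))) : Prop where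
  left : ∀ g ∈ X, g ∈ Board.edgeSet
  right : ∀ g ∈ Y, g ∈ Board.edgeSet
  disj : ∀ g ∈ X, g ∉ Y

lemma IsPosition.insert_left {X Y : Finset (Sym2 (ℕ ⊕ ℕ))} (h : IsPosition X Y)
    {e : Sym2 (ℕ ⊕ ℕ)} (he : Free Board X Y e) : IsPosition (insert e X) Y := by
  refine ⟨?_, h.right, ?_⟩ <;> intro g hg <;> rcases Finset.mem_insert.1 hg with rfl | hg
  exacts [he.1, h.left g hg, he.2.2, h.disj g hg]

lemma IsPosition.insert_right {X Y : Finset (Sym2 (ℕ ⊕ ℕ))} (h : IsPosition X Y)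
    {e : Sym2 (ℕ ⊕ ℕ)} (he : Free Board X Y e) : IsPosition X (insert e Y) := by
  refine ⟨h.left, ?_, ?_⟩ <;> intro g hg
  · rcases Finset.mem_insert.1 hg with rfl | hg
    exacts [he.1, h.right g hg]
  · rw [Finset.mem_insert, not_or]
    exact ⟨fun h' => he.2.1 (h' ▸ hg), h.disj g hg⟩

/-- The player to move, who owns `X`, can avoid losing against the owner of `Y`. -/
def Draws (X Y : Finset (Sym2 (ℕ ⊕ ℕ))) : Prop :=
  IsPosition X Y → ¬ Loses Board K6MinusK4 X Y

lemma not_contains_of_card {Y : Finset (Sym2 (ℕ ⊕ ℕ))} (hY : Y.card ≤ 8)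
    (hb : ∀ g ∈ Y, g ∈ Board.edgeSet) : ¬ Contains K6MinusK4 Y := by
  intro h
  obtain ⟨u, v, P, h1, h2, h3, h4, h5⟩ := exists_book_of_contains h
  have := (LiveBook.card_bookEdges (X := ∅) ⟨h1, h2, h3, h4, fun g hg => hb g (h5 hg), by simp⟩)
  have := Finset.card_le_card h5
  omega

lemma exists_liveBook_of_contains {X Y : Finset (Sym2 (ℕ ⊕ ℕ))} (h : IsPosition X Y)
    (hY : Contains K6MinusK4 Y) : ∃ u v P, LiveBook X u v P ∧ bookEdges u v P ⊆ Y := by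
  obtain ⟨u, v, P, h1, h2, h3, h4, h5⟩ := exists_book_of_contains hY
  exact ⟨u, v, P, ⟨h1, h2, h3, h4, fun g hg => h.right g (h5 hg),
    fun g hg hx => h.disj g hx (h5 hg)⟩, h5⟩

lemma draws_step {X Y : Finset (Sym2 (ℕ ⊕ ℕ))} (hY : Y.card ≤ 8) {e : Sym2 (ℕ ⊕ ℕ)}
    (he : IsPosition X Y → Free Board X Y e)
    (h : ∀ f, IsPosition (insert e X) (insert f Y) → Free Board (insert e X) Y f →
      Draws (insert e X) (insert f Y)) : Draws X Y := by
  intro hp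
  refine not_loses_of_invariant (fun X' Y' => X' = X ∧ Y' = Y) ?_ ⟨rfl, rfl⟩
  rintro _ _ ⟨rfl, rfl⟩
  refine ⟨not_contains_of_card hY hp.right, e, he hp, .inr fun f hf => .inr ?_⟩
  have hp' := (hp.insert_left (he hp)).insert_right hf
  exact h f hp' hf hp'

lemma exists_fresh (j : Bool) (A : Finset (ℕ ⊕ ℕ)) (X : Finset (Sym2 (ℕ ⊕ ℕ))) :
    ∃ y, side y = j ∧ y ∉ A ∧ ∀ g ∈ X, y ∉ g := by
  have hinf : {y : ℕ ⊕ ℕ | side y = j}.Infinite := by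
    cases j
    · exact Set.infinite_of_injective_forall_mem Sum.inr_injective (fun n => by simp [side])
    · exact Set.infinite_of_injective_forall_mem Sum.inl_injective (fun n => by simp [side])
  obtain ⟨y, hy, hn⟩ := hinf.exists_notMem_finset (A ∪ X.biUnion Sym2.toFinset)
  simp only [Finset.mem_union, Finset.mem_biUnion, Sym2.mem_toFinset, not_or, not_exists,
    not_and] at hn
  exact ⟨y, hy, hn⟩

/-! ### Drawing by an endless sequence of threats along a spine -/

section Push

variable {X Y : Finset (Sym2 (ℕ ⊕ ℕ))} {s t : ℕ ⊕ ℕ} {P : Finset (ℕ ⊕ ℕ)}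

lemma not_loses_of_move {e : Sym2 (ℕ ⊕ ℕ)} (hY : ¬ Contains K6MinusK4 Y)
    (he : Free Board X Y e) (h : Contains K6MinusK4 (insert e X) ∨
      ∀ f, Free Board (insert e X) Y f → ¬ Loses Board K6MinusK4 (insert e X) (insert f Y)) :
    ¬ Loses Board K6MinusK4 X Y := by
  refine not_loses_of_invariant (fun X' Y' => X' = X ∧ Y' = Y) ?_ ⟨rfl, rfl⟩
  rintro _ _ ⟨rfl, rfl⟩
  exact ⟨hY, e, he, h.imp_right fun h f hf => .inr (h f hf)⟩

/-- Extending a book with spine `ts`: claim `ty` for a new vertex `y`. The opponent either answers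
with `sy`, or the book gets the page `y`. -/
lemma draws_of_push (hst : s ≠ t) (hside : side s = side t) (hb : bookEdges s t P ⊆ X)
    (Φ : Finset (Sym2 (ℕ ⊕ ℕ)) → Finset (Sym2 (ℕ ⊕ ℕ)) → Prop)
    (hnc : ∀ X Y, IsPosition X Y → Φ X Y → ∀ f, Free Board X Y f →
      ¬ Contains K6MinusK4 (insert f Y))
    (hstar : ∀ X Y y, Φ X Y → y ≠ s → (∀ g ∈ Y, y ∉ g) →
      Φ (insert s(t, y) X) (insert s(s, y) Y))
    (hdev : ∀ X Y y f, IsPosition (insert s(s, y) (insert s(t, y) X)) (insert f Y) → Φ X Y →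
      y ≠ s → y ≠ t → y ∉ P → bookEdges s t (insert y P) ⊆ insert s(s, y) (insert s(t, y) X) →
      (Contains K6MinusK4 (insert s(s, y) (insert s(t, y) X)) ∨
        ∀ f', Draws (insert s(s, y) (insert s(t, y) X)) (insert f' (insert f Y))))
    (hΦ : Φ X Y) : Draws X Y := by
  intro hpos
  have hnc' : ∀ X Y, IsPosition X Y → Φ X Y → ¬ Contains K6MinusK4 Y := by
    intro X Y hp hΦ hc
    obtain ⟨f, hf⟩ := exists_free board_infinite X Y
    exact hnc X Y hp hΦ f hf (hc.mono (Finset.subset_insert _ _))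
  refine not_loses_of_invariant
    (fun X' Y' => IsPosition X' Y' ∧ bookEdges s t P ⊆ X' ∧ Φ X' Y') ?_ ⟨hpos, hb, hΦ⟩
  rintro X Y ⟨hpos, hb, hΦ⟩
  obtain ⟨y, hys, hyA, hyg⟩ := exists_fresh (side s) ({s, t} ∪ P) (X ∪ Y)
  simp only [Finset.mem_union, Finset.mem_insert, Finset.mem_singleton, not_or] at hyA
  obtain ⟨⟨hy1, hy2⟩, hyP⟩ := hyA
  have hyX : ∀ g ∈ X, y ∉ g := fun g hg => hyg g (Finset.mem_union_left _ hg)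
  have hyY : ∀ g ∈ Y, y ∉ g := fun g hg => hyg g (Finset.mem_union_right _ hg)
  have hfree : Free Board X Y s(t, y) :=
    ⟨mem_board.2 ⟨Ne.symm hy2, by rw [hys, hside]⟩, fun h => hyX _ h (by simp),
      fun h => hyY _ h (by simp)⟩
  have hpos1 := hpos.insert_left hfree
  refine ⟨hnc' X Y hpos hΦ, _, hfree, .inr fun f hf => ?_⟩
  have hpos2 := hpos1.insert_right hf
  -- The answer `sy` preserves `Φ`. After any other answer the edge `sy` is still free, and claiming
  -- it turns `y` into a page.
  by_cases hfs : f = s(s, y)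
  · subst hfs
    exact .inl ⟨hpos2, hb.trans (Finset.subset_insert _ _), hstar X Y y hΦ hy1 hyY⟩
  · right
    have hf' : Free Board X Y f := ⟨hf.1, fun h => hf.2.1 (Finset.mem_insert_of_mem h), hf.2.2⟩
    have hfree2 : Free Board (insert s(t, y) X) (insert f Y) s(s, y) := by
      refine ⟨mem_board.2 ⟨Ne.symm hy1, hys.symm⟩, ?_, ?_⟩
      · rw [Finset.mem_insert, not_or]
        refine ⟨fun h => ?_, fun h => hyX _ h (by simp)⟩
        exact hst (Sym2.congr_left.1 h)
      · rw [Finset.mem_insert, not_or]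
        exact ⟨fun h => hfs h.symm, fun h => hyY _ h (by simp)⟩
    have hpos3 := hpos2.insert_left hfree2
    refine not_loses_of_move (hnc X Y hpos hΦ f hf') hfree2 ?_
    refine (hdev X Y y f hpos3 hΦ hy1 hy2 hyP ?_).imp_right fun h f' hf' =>
      h f' (hpos3.insert_right hf')
    refine bookEdges_subset ?_ ?_ ?_
    · exact Finset.mem_insert_of_mem (Finset.mem_insert_of_mem (hb spine_mem))
    · intro p hp
      rcases Finset.mem_insert.1 hp with rfl | hp
      · exact Finset.mem_insert_self _ _
      · exact Finset.mem_insert_of_mem (Finset.mem_insert_of_mem (hb (left_mem hp)))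
    · intro p hp
      rcases Finset.mem_insert.1 hp with rfl | hp
      · exact Finset.mem_insert_of_mem (Finset.mem_insert_self _ _)
      · exact Finset.mem_insert_of_mem (Finset.mem_insert_of_mem (hb (right_mem hp)))

/-- No live book has more than `k` edges in `Y`, even if edges from `s` to new vertices are added
to `Y`. -/
def StarBound (k : ℕ) (X Y : Finset (Sym2 (ℕ ⊕ ℕ))) (s : ℕ ⊕ ℕ) : Prop :=
  ∀ Z : Finset (ℕ ⊕ ℕ), (∀ z ∈ Z, z ≠ s ∧ ∀ g ∈ Y, z ∉ g) → ∀ u v P, LiveBook X u v P →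
    (bookEdges u v P ∩ (Y ∪ Z.image fun z => s(s, z))).card ≤ k

lemma StarBound.card_le {k : ℕ} (h : StarBound k X Y s) {u v : ℕ ⊕ ℕ} {P : Finset (ℕ ⊕ ℕ)}
    (hl : LiveBook X u v P) : (bookEdges u v P ∩ Y).card ≤ k := by
  simpa using h ∅ (by simp) u v P hl

lemma StarBound.anti {k : ℕ} (h : StarBound k X Y s) {X' : Finset (Sym2 (ℕ ⊕ ℕ))}
    (hX : X ⊆ X') : StarBound k X' Y s :=
  fun Z hZ u v P hl => h Z hZ u v P (hl.anti hX)

lemma card_inter_insert_le {α : Type*} [DecidableEq α] (K Y : Finset α) (f : α) :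
    (K ∩ insert f Y).card ≤ (K ∩ Y).card + 1 := by
  refine (Finset.card_le_card (t := insert f (K ∩ Y)) ?_).trans (Finset.card_insert_le _ _)
  intro g
  simp only [Finset.mem_inter, Finset.mem_insert]
  tauto

lemma StarBound.insert {k : ℕ} (h : StarBound k X Y s) (f : Sym2 (ℕ ⊕ ℕ)) :
    StarBound (k + 1) X (insert f Y) s := by
  intro Z hZ u v P hl
  rw [Finset.insert_union]
  refine (card_inter_insert_le _ _ _).trans (Nat.succ_le_succ (h Z (fun z hz => ?_) u v P hl))
  exact ⟨(hZ z hz).1, fun g hg => (hZ z hz).2 g (Finset.mem_insert_of_mem hg)⟩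

/-- Forced answers cost nothing: the bound already allows for every finite set of star edges to new
vertices, so `y` is just one more of these. -/
lemma StarBound.insert_star {k : ℕ} (h : StarBound k X Y s) {y : ℕ ⊕ ℕ} (hys : y ≠ s)
    (hy : ∀ g ∈ Y, y ∉ g) : StarBound k X (Insert.insert s(s, y) Y) s := by
  intro Z hZ u v P hl
  have := h (Insert.insert y Z) ?_ u v P hl
  · refine (Finset.card_le_card ?_).trans this
    refine Finset.inter_subset_inter_left ?_
    intro g
    simp only [Finset.mem_union, Finset.mem_insert, Finset.image_insert]
    tauto
  · intro z hz
    rcases Finset.mem_insert.1 hz with rfl | hz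
    · exact ⟨hys, hy⟩
    · exact ⟨(hZ z hz).1, fun g hg => (hZ z hz).2 g (Finset.mem_insert_of_mem hg)⟩

/-- One further edge raises seven to eight, and a book has nine edges. -/
lemma StarBound.not_contains {k : ℕ} (h : StarBound k X Y s) (hk : k ≤ 7)
    (hpos : IsPosition X Y) {f : Sym2 (ℕ ⊕ ℕ)} (hf : Free Board X Y f) :
    ¬ Contains K6MinusK4 (Insert.insert f Y) := by
  intro hc
  obtain ⟨u, v, P, hl, hsub⟩ := exists_liveBook_of_contains (hpos.insert_right hf) hc
  have h1 := (h.insert f).card_le hl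
  rw [Finset.inter_eq_left.2 hsub, hl.card_bookEdges] at h1
  omega

/-- With three pages and no threat of the opponent, one can threaten forever. -/
lemma draws_of_three_pages (hst : s ≠ t) (hside : side s = side t) (hs : s ∉ P) (ht : t ∉ P)
    (hP : P.card = 3) (hb : bookEdges s t P ⊆ X) (h : StarBound 7 X Y s) : Draws X Y := by
  refine draws_of_push hst hside hb (fun X Y => StarBound 7 X Y s)
    (fun X Y hp hS f hf => hS.not_contains le_rfl hp hf)
    (fun X Y y hS hys hy => (hS.insert_star hys hy).anti (Finset.subset_insert _ _)) ?_ h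
  intro X Y y f hpos hS hys hyt hyP hb'
  left
  refine contains_of_bookEdges hst ?_ ?_ ?_ hb'
  · simp [hs, hys.symm]
  · simp [ht, hyt.symm]
  · rw [Finset.card_insert_of_notMem hyP, hP]

/-- A deviation gives the defender a third page and the opponent the two edges `f` and `f'`; the
bound five leaves exactly this room below the seven required by `draws_of_three_pages`. -/
lemma draws_of_two_pages (hst : s ≠ t) (hside : side s = side t) (hs : s ∉ P) (ht : t ∉ P)
    (hP : P.card = 2) (hb : bookEdges s t P ⊆ X) (h : StarBound 5 X Y s) : Draws X Y := by
  refine draws_of_push hst hside hb (fun X Y => StarBound 5 X Y s)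
    (fun X Y hp hS f hf => hS.not_contains (by norm_num) hp hf)
    (fun X Y y hS hys hy => (hS.insert_star hys hy).anti (Finset.subset_insert _ _)) ?_ h
  intro X Y y f hpos hS hys hyt hyP hb'
  right
  intro f'
  refine draws_of_three_pages hst hside (P := insert y P) ?_ ?_ ?_ hb'
    (((hS.anti ?_).insert f).insert f')
  · simp [hs, hys.symm]
  · simp [ht, hyt.symm]
  · rw [Finset.card_insert_of_notMem hyP, hP]
  · exact (Finset.subset_insert _ _).trans (Finset.subset_insert _ _)

/-- A triangle or a four-cycle of `Y` through `s` that may become part of a live book one of whose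
spine vertices is `s`. -/
def Dangerous (X Y : Finset (Sym2 (ℕ ⊕ ℕ))) (s : ℕ ⊕ ℕ) : Prop :=
  (∃ z p, z ≠ p ∧ s(s, z) ∈ Y ∧ s(s, p) ∈ Y ∧ s(z, p) ∈ Y) ∨
  ∃ z p q, p ≠ q ∧ z ≠ s ∧ s(s, z) ∉ X ∧ s(s, p) ∈ Y ∧ s(s, q) ∈ Y ∧ s(z, p) ∈ Y ∧ s(z, q) ∈ Y

/-- Each page counts at most once, and once more only if both of its edges lie in `E`. Exceeding
five therefore forces full pages, that is, triangles or four-cycles. -/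
lemma card_inter_book_le (u v : ℕ ⊕ ℕ) (P : Finset (ℕ ⊕ ℕ)) (E : Finset (Sym2 (ℕ ⊕ ℕ))) :
    (bookEdges u v P ∩ E).card ≤ (if s(u, v) ∈ E then 1 else 0) + P.card +
      (P.filter fun p => s(u, p) ∈ E ∧ s(v, p) ∈ E).card := by
  set A := P.filter fun p => s(u, p) ∈ E with hA
  set B := P.filter fun p => s(v, p) ∈ E with hB
  have hAB : (P.filter fun p => s(u, p) ∈ E ∧ s(v, p) ∈ E) = A ∩ B := by
    rw [hA, hB, Finset.filter_and]
  have h1 : (A ∪ B).card ≤ P.card :=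
    Finset.card_le_card (Finset.union_subset (Finset.filter_subset _ _) (Finset.filter_subset _ _))
  have h2 := Finset.card_union_add_card_inter A B
  set S : Finset (Sym2 (ℕ ⊕ ℕ)) := if s(u, v) ∈ E then {s(u, v)} else ∅ with hS
  have h3 : bookEdges u v P ∩ E ⊆ S ∪ (A.image (fun p => s(u, p)) ∪ B.image fun p => s(v, p)) := by
    intro g hg
    obtain ⟨hg, hE⟩ := Finset.mem_inter.1 hg
    simp only [Finset.mem_union, Finset.mem_image]
    rcases mem_bookEdges.1 hg with rfl | ⟨p, hp, rfl⟩ | ⟨p, hp, rfl⟩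
    · left
      rw [hS, if_pos hE]
      simp
    · exact .inr (.inl ⟨p, Finset.mem_filter.2 ⟨hp, hE⟩, rfl⟩)
    · exact .inr (.inr ⟨p, Finset.mem_filter.2 ⟨hp, hE⟩, rfl⟩)
  have h4 := (Finset.card_le_card h3).trans (Finset.card_union_le _ _)
  have h5 := Finset.card_union_le (A.image (fun p => s(u, p))) (B.image fun p => s(v, p))
  have h6 : (A.image (fun p => s(u, p))).card ≤ A.card := Finset.card_image_le
  have h7 : (B.image (fun p => s(v, p))).card ≤ B.card := Finset.card_image_le
  have h8 : S.card = if s(u, v) ∈ E then 1 else 0 := by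
    rw [hS]
    split_ifs <;> simp
  rw [hAB]
  omega

/-- The part of the proof of `starBound_of_not_dangerous` in which an edge from `s` to the new
vertex `z` is used and `z` is a spine vertex. -/
lemma card_le_of_spine_new {E : Finset (Sym2 (ℕ ⊕ ℕ))} {u v : ℕ ⊕ ℕ} {P : Finset (ℕ ⊕ ℕ)}
    (hl : LiveBook X u v P) (hE : ∀ g ∈ E, u ∈ g → g = s(s, u)) :
    (bookEdges u v P ∩ E).card ≤ 5 := by
  have h1 := card_inter_book_le u v P E
  have h2 : (P.filter fun p => s(u, p) ∈ E ∧ s(v, p) ∈ E).card +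
      (if s(u, v) ∈ E then 1 else 0) ≤ 1 := by
    have h3 : ∀ w, s(u, w) ∈ E → w = s := by
      intro w hw
      have := hE _ hw (by simp)
      rw [Sym2.eq_swap] at this
      exact Sym2.congr_left.1 this
    have h4 : (P.filter fun p => s(u, p) ∈ E ∧ s(v, p) ∈ E) ⊆ {s} := by
      intro p hp
      exact Finset.mem_singleton.2 (h3 p (Finset.mem_filter.1 hp).2.1)
    have h5 := Finset.card_le_card h4
    rw [Finset.card_singleton] at h5
    split_ifs with huv
    · rw [Finset.card_eq_zero.2]
      rw [Finset.filter_eq_empty_iff]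
      rintro p hp ⟨hp', -⟩
      exact hl.right ((h3 v huv) ▸ (h3 p hp') ▸ hp)
    · exact h5
  rw [hl.card] at h1
  omega

lemma starBound_of_not_dangerous
    (h1 : ∀ u v P, LiveBook X u v P → (bookEdges u v P ∩ Y).card ≤ 5)
    (h2 : ¬ Dangerous X Y s) : StarBound 5 X Y s := by
  intro Z hZ u v P hl
  set E := Y ∪ Z.image fun z => s(s, z) with hE
  have hEZ : ∀ z ∈ Z, ∀ g ∈ E, z ∈ g → g = s(s, z) := by
    intro z hz g hg hzg
    rcases Finset.mem_union.1 hg with hg | hg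
    · exact absurd hzg ((hZ z hz).2 g hg)
    · obtain ⟨z', hz', rfl⟩ := Finset.mem_image.1 hg
      rcases Sym2.mem_iff.1 hzg with rfl | rfl
      · exact absurd rfl (hZ z hz).1
      · rfl
  by_cases hu : u ∈ Z
  · exact card_le_of_spine_new hl (hEZ u hu)
  by_cases hv : v ∈ Z
  · rw [bookEdges_comm]
    exact card_le_of_spine_new hl.symm (hEZ v hv)
  -- With `s` on the spine, more than five edges require the spine and a full page (a triangle at
  -- `s`) or two full pages (a four-cycle at `s`). Star edges do not help: the second edge of a full
  -- page lies in `Y`, so its page vertex is not new.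
  have main : ∀ v, v ∉ Z → LiveBook X s v P → (bookEdges s v P ∩ E).card ≤ 5 := by
    intro v hv hl
    by_contra hcon
    have h3 := card_inter_book_le s v P E
    rw [hl.card] at h3
    have hY : ∀ p ∈ P, s(s, p) ∈ E ∧ s(v, p) ∈ E → s(s, p) ∈ Y ∧ s(v, p) ∈ Y := by
      rintro p hp ⟨hp1, hp2⟩
      have hvY : s(v, p) ∈ Y := by
        rcases Finset.mem_union.1 hp2 with h | h
        · exact h
        · obtain ⟨z, hz, he⟩ := Finset.mem_image.1 h
          rcases Sym2.eq_iff.1 he with ⟨h', -⟩ | ⟨h', -⟩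
          · exact absurd h' hl.ne
          · exact absurd (h' ▸ hp) hl.left
      refine ⟨?_, hvY⟩
      rcases Finset.mem_union.1 hp1 with h | h
      · exact h
      · obtain ⟨z, hz, he⟩ := Finset.mem_image.1 h
        rw [Sym2.congr_right.1 he] at hz
        exact absurd (by simp) ((hZ p hz).2 _ hvY)
    by_cases hsv : s(s, v) ∈ E
    · have hsvY : s(s, v) ∈ Y := by
        rcases Finset.mem_union.1 hsv with h | h
        · exact h
        · obtain ⟨z, hz, he⟩ := Finset.mem_image.1 h
          exact absurd (Sym2.congr_right.1 he ▸ hz) hv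
      rw [if_pos hsv] at h3
      obtain ⟨p, hp⟩ := Finset.card_pos.1
        (show 0 < (P.filter fun p => s(s, p) ∈ E ∧ s(v, p) ∈ E).card by omega)
      obtain ⟨hp, hp'⟩ := Finset.mem_filter.1 hp
      obtain ⟨h4, h5⟩ := hY p hp hp'
      exact h2 (.inl ⟨v, p, (hl.right_ne hp).symm, hsvY, h4, h5⟩)
    · rw [if_neg hsv] at h3
      obtain ⟨p, hp, q, hq, hpq⟩ := Finset.one_lt_card.1
        (show 1 < (P.filter fun p => s(s, p) ∈ E ∧ s(v, p) ∈ E).card by omega)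
      obtain ⟨hp, hp'⟩ := Finset.mem_filter.1 hp
      obtain ⟨hq, hq'⟩ := Finset.mem_filter.1 hq
      obtain ⟨h4, h5⟩ := hY p hp hp'
      obtain ⟨h6, h7⟩ := hY q hq hq'
      exact h2 (.inr ⟨v, p, q, hpq, hl.ne.symm, hl.free _ spine_mem, h4, h6, h5, h7⟩)
  by_cases hus : u = s
  · subst hus
    exact main v hv hl
  by_cases hvs : v = s
  · subst hvs
    rw [bookEdges_comm]
    exact main u hu hl.symm
  -- If neither `s` nor a new vertex is on the spine, the book contains no star edge, since each
  -- edge of a book meets its spine.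
  refine (Finset.card_le_card ?_).trans (h1 u v P hl)
  intro g hg
  obtain ⟨hg, hgE⟩ := Finset.mem_inter.1 hg
  refine Finset.mem_inter.2 ⟨hg, (Finset.mem_union.1 hgE).resolve_right fun h => ?_⟩
  obtain ⟨z, hz, rfl⟩ := Finset.mem_image.1 h
  rcases mem_bookEdges.1 hg with he | ⟨p, hp, he⟩ | ⟨p, hp, he⟩ <;>
    rcases Sym2.eq_iff.1 he with ⟨h', h''⟩ | ⟨h', h''⟩
  exacts [hus h'.symm, hvs h'.symm, hus h', hu (h' ▸ hz), hvs h', hv (h' ▸ hz)]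

/-- A book with two pages suffices for a draw if the opponent has at most five edges of each live
book and one of the two spine vertices is not dangerous. -/
lemma draws_of_spine {a c d : ℕ ⊕ ℕ} (hac : s(a, t) ∈ X) (h1 : s(a, c) ∈ X) (h2 : s(t, c) ∈ X)
    (h3 : s(a, d) ∈ X) (h4 : s(t, d) ∈ X) (hcd : c ≠ d)
    (hY : IsPosition X Y → ∀ u v P, LiveBook X u v P → (bookEdges u v P ∩ Y).card ≤ 5)
    (hD : IsPosition X Y → Dangerous X Y a → Dangerous X Y t → False) : Draws X Y := by
  intro hpos
  obtain ⟨n1, m1⟩ := mem_board.1 (hpos.left _ hac)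
  obtain ⟨n2, -⟩ := mem_board.1 (hpos.left _ h1)
  obtain ⟨n3, -⟩ := mem_board.1 (hpos.left _ h2)
  obtain ⟨n4, -⟩ := mem_board.1 (hpos.left _ h3)
  obtain ⟨n5, -⟩ := mem_board.1 (hpos.left _ h4)
  have hb : bookEdges a t {c, d} ⊆ X := by
    refine bookEdges_subset hac ?_ ?_ <;> simp [*]
  by_cases hDa : Dangerous X Y a
  · have hDt : ¬ Dangerous X Y t := fun h => hD hpos hDa h
    refine draws_of_two_pages (s := t) (t := a) (P := {c, d}) n1.symm m1.symm ?_ ?_ ?_ ?_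
      (starBound_of_not_dangerous (hY hpos) hDt) hpos
    · simp [n3, n5]
    · simp [n2, n4]
    · exact Finset.card_pair hcd
    · rwa [bookEdges_comm]
  · refine draws_of_two_pages (s := a) (t := t) (P := {c, d}) n1 m1 ?_ ?_ ?_ hb
      (starBound_of_not_dangerous (hY hpos) hDa) hpos
    · simp [n2, n4]
    · simp [n3, n5]
    · exact Finset.card_pair hcd

end Push

/-! ### The opponent builds in the other copy -/

section Race

variable {X Y : Finset (Sym2 (ℕ ⊕ ℕ))} {s t u v : ℕ ⊕ ℕ} {P : Finset (ℕ ⊕ ℕ)}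

/-- The invariant may be abandoned at any moment for a position from which a draw is known; this is
how blocking is combined with the threats of `draws_of_three_pages`. -/
lemma draws_of_invariant (I : Finset (Sym2 (ℕ ⊕ ℕ)) → Finset (Sym2 (ℕ ⊕ ℕ)) → Prop)
    (hI : ∀ X Y, IsPosition X Y → I X Y → ¬ Contains K6MinusK4 Y ∧ (Draws X Y ∨
      ∃ e, Free Board X Y e ∧ ∀ f, Free Board (insert e X) Y f → I (insert e X) (insert f Y)))
    (h : I X Y) : Draws X Y := by
  intro hpos
  refine not_loses_of_invariant (fun X Y => ¬ Contains K6MinusK4 Y ∧ IsPosition X Y ∧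
    (¬ Loses Board K6MinusK4 X Y ∨ I X Y)) ?_ ⟨(hI X Y hpos h).1, hpos, .inr h⟩
  rintro X Y ⟨hc, hpos, h⟩
  by_cases hL : ¬ Loses Board K6MinusK4 X Y
  · obtain ⟨-, e, he, h'⟩ := exists_move_of_not_loses hL
    exact ⟨hc, e, he, h'.imp_right fun h' f hf => .inr (h' f hf)⟩
  · obtain ⟨-, h' | ⟨e, he, h'⟩⟩ := hI X Y hpos (h.resolve_left hL)
    · exact absurd (h' hpos) hL
    · refine ⟨hc, e, he, .inr fun f hf => .inl ?_⟩
      have hpos' := (hpos.insert_left he).insert_right hf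
      exact ⟨(hI _ _ hpos' (h' f hf)).1, hpos', .inr (h' f hf)⟩

/-- The opponent, to move, has a book with spine `uv` and three pages, and all the other ways to
complete it have been blocked, or the spine itself has been blocked. -/
structure Contained (X Y : Finset (Sym2 (ℕ ⊕ ℕ))) (s u v : ℕ ⊕ ℕ) : Prop where
  cover : ∀ g ∈ Y, s ∈ g ∨ u ∈ g ∨ v ∈ g
  pages : s(u, v) ∈ X ∨ ∃ T : Finset (ℕ ⊕ ℕ), T.card ≤ 3 ∧ ∀ x, x ≠ u → x ≠ v →
    (s(u, x) ∈ Y ∨ s(v, x) ∈ Y) → x ∈ T ∨ s(u, x) ∈ X ∨ s(v, x) ∈ X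

namespace Contained

variable {g : Sym2 (ℕ ⊕ ℕ)} {a b : ℕ ⊕ ℕ}

/-- A spine vertex `a` has five neighbours in the book, and at most two book edges are outside `Y`,
so at least three edges of `Y` join `a` to vertices of its own copy. If `a` is not one of `s`, `u`,
`v`, the cover condition puts these neighbours in `{s}` or in `{u, v}`, which is too few. -/
lemma spine (h : Contained X Y s u v) (hsu : side s ≠ side u) (huv : side u = side v)
    (hl : LiveBook X a b P) (h8 : 8 ≤ (bookEdges a b P ∩ insert g Y).card) :
    a = s ∨ a = u ∨ a = v := by
  by_contra hcon
  push Not at hcon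
  obtain ⟨has, hau, hav⟩ := hcon
  set N := insert b P with hN
  have hNc : N.card = 5 := by rw [hN, Finset.card_insert_of_notMem hl.right, hl.card]
  have hNK : ∀ n ∈ N, s(a, n) ∈ bookEdges a b P := by
    intro n hn
    rcases Finset.mem_insert.1 hn with rfl | hn
    exacts [spine_mem, left_mem hn]
  have h7 := card_inter_insert_le (bookEdges a b P) Y g
  have h2 : (bookEdges a b P \ Y).card ≤ 2 := by
    have := Finset.card_sdiff_add_card_inter (bookEdges a b P) Y
    rw [hl.card_bookEdges] at this
    omega
  have h3 : (N.filter fun n => s(a, n) ∉ Y).card ≤ 2 := by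
    refine le_trans ?_ h2
    rw [← Finset.card_image_of_injOn (f := fun n => s(a, n))]
    · apply Finset.card_le_card
      intro e he
      obtain ⟨n, hn, rfl⟩ := Finset.mem_image.1 he
      obtain ⟨hn, hn'⟩ := Finset.mem_filter.1 hn
      exact Finset.mem_sdiff.2 ⟨hNK n hn, hn'⟩
    · exact fun x _ y _ hxy => Sym2.congr_right.1 hxy
  have h4 := Finset.card_filter_add_card_filter_not (s := N) (fun n => s(a, n) ∈ Y)
  have h5 : (N.filter fun n => s(a, n) ∈ Y).card ≤ 2 := by
    have hmem : ∀ n ∈ N.filter fun n => s(a, n) ∈ Y, (n = s ∨ n = u ∨ n = v) ∧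
        side n = side a := by
      intro n hn
      obtain ⟨hn, hn'⟩ := Finset.mem_filter.1 hn
      refine ⟨?_, hl.side_of_mem (hNK n hn) (by simp)⟩
      rcases h.cover _ hn' with h | h | h <;> rcases Sym2.mem_iff.1 h with h | h <;>
        simp_all
    by_cases hsa : side a = side s
    · refine (Finset.card_le_card (t := {s}) fun n hn => ?_).trans (by simp)
      obtain ⟨h | h | h, h'⟩ := hmem n hn
      · simp [h]
      · exact absurd (by rw [← h, h', hsa]) hsu
      · exact absurd (by rw [huv, ← h, h', hsa]) hsu
    · refine (Finset.card_le_card (t := {u, v}) fun n hn => ?_).trans Finset.card_le_two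
      obtain ⟨h | h | h, h'⟩ := hmem n hn
      · exact absurd (by rw [← h', h]) hsa
      · simp [h]
      · simp [h]
  omega

lemma spines_eq (ha : a = s ∨ a = u ∨ a = v) (hb : b = s ∨ b = u ∨ b = v) (hab : a ≠ b)
    (hba : side b = side a) (hsu : side s ≠ side u) (huv : side u = side v) :
    (a = u ∧ b = v) ∨ (a = v ∧ b = u) := by
  rcases ha with rfl | rfl | rfl <;> rcases hb with rfl | rfl | rfl <;> first | tauto | grind

/-- The spine of a threatened book must be `uv`. At most three of its four pages can have been
started before `g`, so some page `q` had no edge of `Y`. Since at most one book edge is now missing,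
`g` is one edge of this page, and the other edge is the block. -/
lemma exists_threat (h : Contained X Y s u v) (hsu : side s ≠ side u) (huv : side u = side v)
    (hl : LiveBook X a b P) (h8 : 8 ≤ (bookEdges a b P ∩ insert g Y).card) :
    ∃ q, q ≠ u ∧ q ≠ v ∧ Free Board X Y s(u, q) ∧ Free Board X Y s(v, q) ∧
      (g = s(u, q) ∨ g = s(v, q)) ∧ s(u, q) ∈ bookEdges a b P ∧ s(v, q) ∈ bookEdges a b P := by
  have main : ∀ {u v}, (s(u, v) ∈ X ∨ ∃ T : Finset (ℕ ⊕ ℕ), T.card ≤ 3 ∧ ∀ x, x ≠ u → x ≠ v →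
      (s(u, x) ∈ Y ∨ s(v, x) ∈ Y) → x ∈ T ∨ s(u, x) ∈ X ∨ s(v, x) ∈ X) → LiveBook X u v P →
      8 ≤ (bookEdges u v P ∩ insert g Y).card →
      ∃ q, q ≠ u ∧ q ≠ v ∧ Free Board X Y s(u, q) ∧ Free Board X Y s(v, q) ∧
      (g = s(u, q) ∨ g = s(v, q)) ∧ s(u, q) ∈ bookEdges u v P ∧ s(v, q) ∈ bookEdges u v P := by
    intro u v hp hl h8
    obtain ⟨T, hT, hT'⟩ := hp.resolve_left (hl.free _ spine_mem)
    obtain ⟨q, hq, hqT⟩ : ∃ q ∈ P, q ∉ T := by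
      by_contra! hcon
      have := Finset.card_le_card hcon
      rw [hl.card] at this
      omega
    have hu := hl.free _ (left_mem hq)
    have hv := hl.free _ (right_mem hq)
    have hY : ¬ (s(u, q) ∈ Y ∨ s(v, q) ∈ Y) := by
      intro hY
      rcases hT' q (hl.left_ne hq) (hl.right_ne hq) hY with h | h | h
      exacts [hqT h, hu h, hv h]
    rw [not_or] at hY
    refine ⟨q, hl.left_ne hq, hl.right_ne hq, ⟨hl.board _ (left_mem hq), hu, hY.1⟩,
      ⟨hl.board _ (right_mem hq), hv, hY.2⟩, ?_, left_mem hq, right_mem hq⟩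
    by_contra hcon
    rw [not_or] at hcon
    have h1 := Finset.card_sdiff_add_card_inter (bookEdges u v P) (insert g Y)
    rw [hl.card_bookEdges] at h1
    have h2 : 1 < (bookEdges u v P \ insert g Y).card := by
      refine Finset.one_lt_card.2 ⟨s(u, q), ?_, s(v, q), ?_, ?_⟩
      · simp [left_mem hq, hY.1, Ne.symm hcon.1]
      · simp [right_mem hq, hY.2, Ne.symm hcon.2]
      · exact fun h => hl.ne (Sym2.congr_left.1 h)
    omega
  have hba := hl.side_right
  have ha := h.spine hsu huv hl h8
  have hb := h.spine hsu huv hl.symm (bookEdges_comm a b P ▸ h8)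
  have hab := hl.ne
  have hcase := spines_eq ha hb hab hba hsu huv
  rcases hcase with ⟨rfl, rfl⟩ | ⟨rfl, rfl⟩
  · exact main h.pages hl h8
  · rw [bookEdges_comm] at h8 ⊢
    exact main h.pages hl.symm h8

end Contained

/-- A book has six vertices, so a star contributes at most five edges to it. -/
lemma card_inter_le_of_cover (hl : LiveBook X u v P) {E F : Finset (Sym2 (ℕ ⊕ ℕ))}
    (hE : ∀ g ∈ bookEdges u v P, g ∈ E → s ∈ g ∨ g ∈ F) :
    (bookEdges u v P ∩ E).card ≤ 5 + F.card := by
  have h1 : bookEdges u v P ∩ E ⊆ (bookEdges u v P).filter (s ∈ ·) ∪ F := by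
    intro g hg
    obtain ⟨hg, hgE⟩ := Finset.mem_inter.1 hg
    rw [Finset.mem_union, Finset.mem_filter]
    exact (hE g hg hgE).imp_left fun h => ⟨hg, h⟩
  refine (Finset.card_le_card h1).trans ((Finset.card_union_le _ _).trans ?_)
  have := hl.card_filter_mem_le s
  omega

/-- A star bound for a set of edges which, in the copy of `K_ω` containing `s`, consists of edges
at `s` and at most two further edges. -/
lemma starBound_of_cover {F : Finset (Sym2 (ℕ ⊕ ℕ))} (hF : F.card ≤ 2)
    (hE : ∀ g ∈ Y, (∀ x ∈ g, side x = side s) → s ∈ g ∨ g ∈ F)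
    (h7 : ∀ u v P, LiveBook X u v P → side u ≠ side s → (bookEdges u v P ∩ Y).card ≤ 7) :
    StarBound 7 X Y s := by
  intro Z hZ u v P hl
  by_cases hus : side u = side s
  · refine (card_inter_le_of_cover (s := s) (F := F) hl fun g hg hgE => ?_).trans (by omega)
    rcases Finset.mem_union.1 hgE with h | h
    · exact hE g h fun x hx => (hl.side_of_mem hg hx).trans hus
    · obtain ⟨z, hz, rfl⟩ := Finset.mem_image.1 h
      simp
  · refine (Finset.card_le_card fun g hg => ?_).trans (h7 u v P hl hus)
    obtain ⟨hg, hgE⟩ := Finset.mem_inter.1 hg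
    refine Finset.mem_inter.2 ⟨hg, (Finset.mem_union.1 hgE).resolve_right fun h => ?_⟩
    obtain ⟨z, hz, rfl⟩ := Finset.mem_image.1 h
    exact hus (hl.side_of_mem hg (x := s) (by simp)).symm

/-- Containment is maintained for the edges owned before the last move `g`. Either `g` creates no
threat and three pages suffice, or claiming the other edge of the new page `q` blocks that page and
restores containment. -/
lemma draws_of_contained (hst : s ≠ t) (hside : side s = side t) (hs : s ∉ P) (ht : t ∉ P)
    (hP : P.card = 3) (hb : bookEdges s t P ⊆ X) (hsu : side s ≠ side u) (huv : side u = side v)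
    (h : Contained X Y s u v) {g : Sym2 (ℕ ⊕ ℕ)} (hg : Free Board X Y g) :
    Draws X (insert g Y) := by
  refine draws_of_invariant (fun X Y' => ∃ Y g, Y' = insert g Y ∧ Free Board X Y g ∧
    bookEdges s t P ⊆ X ∧ Contained X Y s u v) ?_ ⟨Y, g, rfl, hg, hb, h⟩
  rintro X Y' hpos ⟨Y, g, rfl, hg, hb, h⟩
  constructor
  · intro hc
    obtain ⟨a, b, Q, hl, hsub⟩ := exists_liveBook_of_contains hpos hc
    obtain ⟨q, hqu, hqv, h1, h2, -, h3, h4⟩ := h.exists_threat (g := g) hsu huv hl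
      (by rw [Finset.inter_eq_left.2 hsub, hl.card_bookEdges]; omega)
    have h5 := (Finset.mem_insert.1 (hsub h3)).resolve_right h1.2.2
    have h6 := (Finset.mem_insert.1 (hsub h4)).resolve_right h2.2.2
    have huv' : u = v := Sym2.congr_left.1 (h5.trans h6.symm)
    subst huv'
    have ha := h.spine (g := g) hsu huv hl
      (by rw [Finset.inter_eq_left.2 hsub, hl.card_bookEdges]; omega)
    have hb := h.spine (g := g) hsu huv hl.symm
      (by rw [bookEdges_comm, Finset.inter_eq_left.2 hsub, hl.card_bookEdges]; omega)
    have := Contained.spines_eq ha hb hl.ne hl.side_right hsu huv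
    exact hl.ne (by grind)
  by_cases hth : ∃ a b Q, LiveBook X a b Q ∧ 8 ≤ (bookEdges a b Q ∩ insert g Y).card
  · obtain ⟨a, b, Q, hl, h8⟩ := hth
    obtain ⟨q, hqu, hqv, h1, h2, hgq, -, -⟩ := h.exists_threat hsu huv hl h8
    have hne : u ≠ v := by
      rintro rfl
      have ha := h.spine hsu huv hl h8
      have hb := h.spine hsu huv hl.symm (bookEdges_comm a b Q ▸ h8)
      have := Contained.spines_eq ha hb hl.ne hl.side_right hsu huv
      exact hl.ne (by grind)
    have hne' : s(u, q) ≠ s(v, q) := fun h => hne (Sym2.congr_left.1 h)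
    have key : ∀ e, (e = s(u, q) ∨ e = s(v, q)) → (g = s(u, q) ∨ g = s(v, q)) → e ≠ g →
        ∃ e, Free Board X (insert g Y) e ∧ ∀ f, Free Board (insert e X) (insert g Y) f →
        ∃ Y_1 g_1, insert f (insert g Y) = insert g_1 Y_1 ∧ Free Board (insert e X) Y_1 g_1 ∧
        bookEdges s t P ⊆ insert e X ∧ Contained (insert e X) Y_1 s u v := by
      intro e he hgq heg
      have hef : Free Board X Y e := by rcases he with rfl | rfl <;> assumption
      refine ⟨e, ⟨hef.1, hef.2.1, by simp [heg, hef.2.2]⟩, fun f hf => ⟨insert g Y, f, rfl, hf,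
        hb.trans (Finset.subset_insert _ _), ?_, ?_⟩⟩
      · intro g' hg'
        rcases Finset.mem_insert.1 hg' with rfl | hg'
        · rcases hgq with rfl | rfl <;> simp
        · exact h.cover g' hg'
      · refine h.pages.imp (fun h => Finset.mem_insert_of_mem h) ?_
        rintro ⟨T, hT, hT'⟩
        refine ⟨T, hT, fun x hxu hxv hx => ?_⟩
        by_cases hxq : x = q
        · subst hxq
          rcases he with rfl | rfl <;> simp
        · have : s(u, x) ∈ Y ∨ s(v, x) ∈ Y := by
            refine hx.imp (fun hx => (Finset.mem_insert.1 hx).resolve_left ?_)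
              (fun hx => (Finset.mem_insert.1 hx).resolve_left ?_) <;>
            · rintro rfl
              simp only [Sym2.eq_iff] at hgq
              tauto
          exact (hT' x hxu hxv this).imp_right
            (Or.imp Finset.mem_insert_of_mem Finset.mem_insert_of_mem)
    right
    rcases hgq with rfl | rfl
    · exact key s(v, q) (.inr rfl) (.inl rfl) hne'.symm
    · exact key s(u, q) (.inl rfl) (.inr rfl) hne'
  · left
    push Not at hth
    refine draws_of_three_pages hst hside hs ht hP hb (starBound_of_cover (F := {g}) (by simp)
      (fun e he hes => ?_) fun a b Q hl _ => Nat.le_of_lt_succ (hth a b Q hl))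
    rcases Finset.mem_insert.1 he with rfl | he
    · simp
    · rcases h.cover e he with h | h | h
      · exact .inl h
      · exact absurd (hes u h) hsu.symm
      · exact absurd (hes v h) (huv ▸ hsu.symm)

/-- If the opponent has spent six moves on the other board and, on this board, has only answered
threats, then two pages suffice for a draw. -/
lemma draws_of_race (hst : s ≠ t) (hside : side s = side t) (hs : s ∉ P) (ht : t ∉ P)
    (hP : P.card = 2) (hb : bookEdges s t P ⊆ X) {R : Finset (Sym2 (ℕ ⊕ ℕ))} (hR : R.card ≤ 6)
    (hY : ∀ g ∈ Y, s ∈ g ∨ g ∈ R) (hRs : ∀ g ∈ R, ∀ x ∈ g, side x ≠ side s) : Draws X Y := by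
  refine draws_of_push hst hside hb (fun X Y => ∀ g ∈ Y, s ∈ g ∨ g ∈ R) ?_ ?_ ?_ hY
  · intro X Y hpos hY f hf hc
    obtain ⟨u, v, Q, hl, hsub⟩ := exists_liveBook_of_contains (hpos.insert_right hf) hc
    have h1 := card_inter_insert_le (bookEdges u v Q) Y f
    rw [Finset.inter_eq_left.2 hsub, hl.card_bookEdges] at h1
    have h2 : (bookEdges u v Q ∩ Y).card ≤ 6 := by
      by_cases hus : side u = side s
      · refine (card_inter_le_of_cover (s := s) (F := ∅) hl fun g hg hgE => ?_).trans (by simp)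
        refine .inl ((hY g hgE).resolve_right fun h => ?_)
        induction g with
        | h x y => exact hRs _ h x (by simp) ((hl.side_of_mem hg (by simp)).trans hus)
      · refine (Finset.card_le_card (t := R) fun g hg => ?_).trans hR
        obtain ⟨hg, hgE⟩ := Finset.mem_inter.1 hg
        exact (hY g hgE).resolve_left fun h => hus (hl.side_of_mem hg h).symm
    omega
  · intro X Y y hY hys hy g hg
    rcases Finset.mem_insert.1 hg with rfl | hg
    · simp
    · exact hY g hg
  intro X Y y f hpos hY hys hyt hyP hb'
  right
  intro f' hpos'
  set X' := insert s(s, y) (insert s(t, y) X) with hX'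
  set Y' := insert f' (insert f Y) with hY'
  have hs' : s ∉ insert y P := by simp [hs, hys.symm]
  have ht' : t ∉ insert y P := by simp [ht, hyt.symm]
  have hP' : (insert y P).card = 3 := by rw [Finset.card_insert_of_notMem hyP, hP]
  have hR' : ∀ g ∈ R, ¬ ∀ x ∈ g, side x = side s := by
    intro g hg h
    induction g with
    | h x y => exact hRs _ hg x (by simp) (h x (by simp))
  have hcov : ∀ g ∈ Y', (∀ x ∈ g, side x = side s) → s ∈ g ∨ g ∈ ({f', f} : Finset _) := by
    intro g hg hgs
    simp only [hY', Finset.mem_insert] at hg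
    rcases hg with rfl | rfl | hg
    · simp
    · simp
    · exact .inl ((hY g hg).resolve_right fun h => hR' g h hgs)
  by_cases hth : ∃ u v Q, LiveBook X' u v Q ∧ side u ≠ side s ∧ 8 ≤ (bookEdges u v Q ∩ Y').card
  swap
  · push Not at hth
    exact draws_of_three_pages hst hside hs' ht' hP' hb' (starBound_of_cover
      Finset.card_le_two hcov fun u v Q hl hu => Nat.le_of_lt_succ (hth u v Q hl hu)) hpos'
  obtain ⟨u, v, Q, hl, hus, h8⟩ := hth
  have hsub : bookEdges u v Q ∩ Y' ⊆ insert f' (insert f R) := by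
    intro g hg
    obtain ⟨hg, hgY⟩ := Finset.mem_inter.1 hg
    simp only [hY', Finset.mem_insert] at hgY ⊢
    refine hgY.imp_right (Or.imp_right fun h => (hY g h).resolve_left fun h' => ?_)
    exact hus (hl.side_of_mem hg h').symm
  have hcard : (insert f' (insert f R)).card ≤ 8 := by
    have h1 := Finset.card_insert_le f' (insert f R)
    have h2 := Finset.card_insert_le f R
    omega
  -- At most eight edges are available, six from `R` and the two free moves, and the threat uses
  -- eight. So all of them lie in this one book, and the opponent has nothing else outside the star
  -- at `s`.
  have heq : bookEdges u v Q ∩ Y' = insert f' (insert f R) :=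
    Finset.eq_of_subset_of_card_le hsub (hcard.trans h8)
  have hcard' : (bookEdges u v Q \ Y').card = 1 := by
    have := Finset.card_sdiff_add_card_inter (bookEdges u v Q) Y'
    rw [heq, hl.card_bookEdges] at this
    rw [heq] at h8
    omega
  obtain ⟨e, he⟩ := Finset.card_eq_one.1 hcard'
  have heK : e ∈ bookEdges u v Q \ Y' := by rw [he]; simp
  obtain ⟨heK, heY⟩ := Finset.mem_sdiff.1 heK
  have hefree : Free Board X' Y' e := ⟨hl.board e heK, hl.free e heK, heY⟩
  have hYK : ∀ g ∈ Y', s ∈ g ∨ g ∈ bookEdges u v Q := by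
    intro g hg
    have : s ∈ g ∨ g ∈ insert f' (insert f R) := by
      simp only [hY', Finset.mem_insert] at hg ⊢
      rcases hg with h | h | h
      · simp [h]
      · simp [h]
      · exact (hY g h).imp_right fun h => .inr (.inr h)
    refine this.imp_right fun h => ?_
    rw [← heq] at h
    exact (Finset.mem_inter.1 h).1
  have hcont : Contained (insert e X') Y' s u v := by
    constructor
    · intro g hg
      refine (hYK g hg).imp_right fun h => ?_
      rcases mem_bookEdges.1 h with rfl | ⟨p, hp, rfl⟩ | ⟨p, hp, rfl⟩ <;> simp
    · by_cases heuv : e = s(u, v)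
      · exact .inl (by simp [heuv])
      right
      have hpage : ∀ x, x ≠ u → x ≠ v → (s(u, x) ∈ Y' ∨ s(v, x) ∈ Y') → x ∈ Q := by
        intro x hxu hxv hx
        have hK : s(u, x) ∈ bookEdges u v Q ∨ s(v, x) ∈ bookEdges u v Q := by
          refine hx.imp (fun h => (hYK _ h).resolve_left fun h' => ?_)
            (fun h => (hYK _ h).resolve_left fun h' => ?_)
          · have hbd := (mem_board.1 (hpos'.right _ h)).2
            rcases Sym2.mem_iff.1 h' with rfl | rfl
            · exact hus rfl
            · exact hus hbd
          · have hbd := (mem_board.1 (hpos'.right _ h)).2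
            have := hl.side_right
            rcases Sym2.mem_iff.1 h' with rfl | rfl
            · exact hus this.symm
            · exact hus (this.symm.trans hbd)
        rcases hK with h | h <;>
          exact ((LiveBook.mem_or_of_mem h (x := x) (by simp)).resolve_left hxu).resolve_left hxv
      obtain ⟨q, hq, heq'⟩ : ∃ q ∈ Q, e = s(u, q) ∨ e = s(v, q) := by
        rcases mem_bookEdges.1 heK with h | ⟨p, hp, h⟩ | ⟨p, hp, h⟩
        exacts [absurd h heuv, ⟨p, hp, .inl h.symm⟩, ⟨p, hp, .inr h.symm⟩]
      -- The block `e` lies on the page `q`, so only the other three pages remain usable.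
      refine ⟨Q.erase q, by rw [Finset.card_erase_of_mem hq, hl.card], fun x hxu hxv hx => ?_⟩
      by_cases hxq : x = q
      · subst hxq
        rcases heq' with rfl | rfl <;> simp
      · exact .inl (Finset.mem_erase.2 ⟨hxq, hpage x hxu hxv hx⟩)
  have hnc : ¬ Contains K6MinusK4 Y' := by
    intro hc
    obtain ⟨u₁, v₁, Q₁, hl₁, hsub₁⟩ := exists_liveBook_of_contains hpos' hc
    by_cases hu₁ : side u₁ = side s
    · have := card_inter_le_of_cover (s := s) (F := {f', f}) (E := Y') hl₁
        fun g hg hgE => hcov g hgE fun x hx => (hl₁.side_of_mem hg hx).trans hu₁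
      rw [Finset.inter_eq_left.2 hsub₁, hl₁.card_bookEdges] at this
      have := Finset.card_le_two (a := f') (b := f)
      omega
    · have : bookEdges u₁ v₁ Q₁ ⊆ insert f' (insert f R) := by
        intro g hg
        have hgY := hsub₁ hg
        simp only [hY', Finset.mem_insert] at hgY ⊢
        refine hgY.imp_right (Or.imp_right fun h => (hY g h).resolve_left fun h' => ?_)
        exact hu₁ (hl₁.side_of_mem hg h').symm
      have := Finset.card_le_card this
      rw [hl₁.card_bookEdges] at this
      omega
  refine not_loses_of_move hnc hefree (.inr fun g hg => ?_)
  exact draws_of_contained hst hside hs' ht' hP' (hb'.trans (Finset.subset_insert _ _)) hus.symm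
    hl.side_right.symm hcont hg ((hpos'.insert_left hefree).insert_right hg)

end Race

/-! ### Positions with two pages, settled by counting the opponent's edges -/

section Final

variable {X Y : Finset (Sym2 (ℕ ⊕ ℕ))}

lemma length_le_card {α : Type*} {S : Finset α} {l : List α} (hl : l.Nodup)
    (h : ∀ e ∈ l, e ∈ S) : l.length ≤ S.card := by
  classical
  rw [← List.toFinset_card_of_nodup hl]
  exact Finset.card_le_card fun e he => h e (List.mem_toFinset.1 he)

/-- Each listed edge of the opponent outside the book lowers the total by one; this yields the bound
five required by `draws_of_spine`. -/
lemma card_inter_le_of_list {α : Type*} [DecidableEq α] {K Y : Finset α} {n : ℕ} {l : List α}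
    (hl : l.Nodup) (h : ∀ e ∈ l, e ∈ Y ∧ e ∉ K) (hn : Y.card ≤ n + l.length) :
    (K ∩ Y).card ≤ n := by
  have h1 : l.length ≤ (Y \ K).card := length_le_card hl fun e he => Finset.mem_sdiff.2 (h e he)
  have h2 := Finset.card_sdiff_add_card_inter Y K
  rw [Finset.inter_comm] at h2
  omega

/-- Spine vertices are adjacent to every other vertex of the book, so two book vertices joined by an
edge of `X` are both pages. Together with `LiveBook.not_pages` this prevents several given edges
from sharing a live book. -/
lemma LiveBook.pages_of_mem {u v : ℕ ⊕ ℕ} {P : Finset (ℕ ⊕ ℕ)} (h : LiveBook X u v P)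
    {x y : ℕ ⊕ ℕ} (hxy : s(x, y) ∈ X) (hne : x ≠ y) (hx : x = u ∨ x = v ∨ x ∈ P)
    (hy : y = u ∨ y = v ∨ y ∈ P) : x ∈ P ∧ y ∈ P := by
  have h1 : ∀ {x y}, s(x, y) ∈ X → x ≠ y → (x = u ∨ x = v ∨ x ∈ P) → (y = u ∨ y = v ∨ y ∈ P) →
      x ∈ P := by
    intro x y hxy hne hx hy
    by_contra hxP
    refine h.free _ ?_ hxy
    rcases hx with rfl | rfl | hx
    · rcases hy with rfl | rfl | hy
      exacts [absurd rfl hne, spine_mem, left_mem hy]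
    · rcases hy with rfl | rfl | hy
      exacts [Sym2.eq_swap ▸ spine_mem, absurd rfl hne, right_mem hy]
    · exact absurd hx hxP
  exact ⟨h1 hxy hne hx hy, h1 (Sym2.eq_swap ▸ hxy) hne.symm hy hx⟩

lemma LiveBook.not_pages {u v : ℕ ⊕ ℕ} {P : Finset (ℕ ⊕ ℕ)} (h : LiveBook X u v P)
    {x y : ℕ ⊕ ℕ} (hxy : s(x, y) ∈ bookEdges u v P) : ¬ (x ∈ P ∧ y ∈ P) := by
  rintro ⟨hx, hy⟩
  have := h.left
  have := h.right
  rcases mem_bookEdges.1 hxy with h | ⟨p, hp, h⟩ | ⟨p, hp, h⟩ <;>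
    rcases Sym2.eq_iff.1 h with ⟨rfl, rfl⟩ | ⟨rfl, rfl⟩ <;> contradiction

lemma IsPosition.ne_of_left (h : IsPosition X Y) {x y : ℕ ⊕ ℕ} (hxy : s(x, y) ∈ X) : x ≠ y :=
  (mem_board.1 (h.left _ hxy)).1

lemma IsPosition.side_left (h : IsPosition X Y) {x y : ℕ ⊕ ℕ} (hxy : s(x, y) ∈ X) :
    side y = side x := (mem_board.1 (h.left _ hxy)).2.symm

lemma IsPosition.ne_of_right (h : IsPosition X Y) {x y : ℕ ⊕ ℕ} (hxy : s(x, y) ∈ Y) : x ≠ y :=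
  (mem_board.1 (h.right _ hxy)).1

lemma IsPosition.side_right (h : IsPosition X Y) {x y : ℕ ⊕ ℕ} (hxy : s(x, y) ∈ Y) :
    side y = side x := (mem_board.1 (h.right _ hxy)).2.symm

/-- The edge `ww'` lies in the other copy, so one edge fewer is available in the copy of `a`.
Listing more distinct edges there than this allows gives the contradictions below. -/
lemma length_le_of_side {a w w' : ℕ ⊕ ℕ} {n : ℕ} {l : List ((ℕ ⊕ ℕ) × (ℕ ⊕ ℕ))}
    (hpos : IsPosition X Y) (hY : Y.card ≤ n + 1) (hw : s(w, w') ∈ Y) (hwa : side w ≠ side a)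
    (hl : (l.map fun q => s(q.1, q.2)).Nodup)
    (h : ∀ q ∈ l, s(q.1, q.2) ∈ Y ∧ side q.1 = side a) : l.length ≤ n := by
  have h1 : (l.map fun q => s(q.1, q.2)).length ≤ (Y.erase s(w, w')).card := by
    refine length_le_card hl fun e he => ?_
    obtain ⟨q, hq, rfl⟩ := List.mem_map.1 he
    refine Finset.mem_erase.2 ⟨fun h' => ?_, (h q hq).1⟩
    have hs := (h q hq).2
    rcases Sym2.eq_iff.1 h' with ⟨h1, -⟩ | ⟨h1, -⟩
    · exact hwa (h1 ▸ hs)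
    · exact hwa ((hpos.side_right hw).symm.trans (h1 ▸ hs))
  rw [Finset.card_erase_of_mem hw, List.length_map] at h1
  omega

lemma IsPosition.facts (h : IsPosition X Y) :
    (∀ x y, s(x, y) ∈ X → s(y, x) ∈ X) ∧ (∀ x y, s(x, y) ∈ Y → s(y, x) ∈ Y) ∧
    (∀ x y, s(x, y) ∈ X → s(x, y) ∉ Y) ∧ (∀ x y, s(x, y) ∈ X → x ≠ y) ∧
    ∀ x y, s(x, y) ∈ Y → x ≠ y :=
  ⟨fun _ _ h => Sym2.eq_swap ▸ h, fun _ _ h => Sym2.eq_swap ▸ h, fun _ _ hx => h.disj _ hx,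
    fun _ _ => h.ne_of_left, fun _ _ => h.ne_of_right⟩

/-- This replaces a set of edges by an abstract relation. -/
lemma exists_rel (X : Finset (Sym2 (ℕ ⊕ ℕ))) :
    ∃ A : ℕ ⊕ ℕ → ℕ ⊕ ℕ → Prop, ∀ x y, s(x, y) ∈ X ↔ A x y :=
  ⟨_, fun _ _ => Iff.rfl⟩

/-- The common edge-counting content of a triangle and a four-cycle: two edges at `a`, and from each
far end an edge leading away from `a`. The conditions on `az₁` and `az₂` keep these edges distinct
from edges at known neighbours of `a` in `X`. -/
lemma Dangerous.exists_edges (hpos : IsPosition X Y) {a : ℕ ⊕ ℕ} (h : Dangerous X Y a) :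
    ∃ p q z₁ z₂, p ≠ q ∧ s(a, p) ∈ Y ∧ s(a, q) ∈ Y ∧ s(p, z₁) ∈ Y ∧ s(q, z₂) ∈ Y ∧ z₁ ≠ a ∧
      z₂ ≠ a ∧ s(a, z₁) ∉ X ∧ s(a, z₂) ∉ X := by
  rcases h with ⟨z, p, h1, h2, h3, h4⟩ | ⟨z, p, q, h1, h2, h3, h4, h5, h6, h7⟩
  · exact ⟨z, p, p, z, h1, h2, h3, h4, Sym2.eq_swap ▸ h4, (hpos.ne_of_right h3).symm,
      (hpos.ne_of_right h2).symm, fun h => hpos.disj _ h h3, fun h => hpos.disj _ h h2⟩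
  · exact ⟨p, q, z, z, h1, h4, h5, Sym2.eq_swap ▸ h6, Sym2.eq_swap ▸ h7, h2, h2, h3, h3⟩

/-- The strategy succeeds if the opponent has wasted an edge at one of the two pages. -/
lemma draws_of_touched_page {a t c d w w' n : ℕ ⊕ ℕ} (hat : s(a, t) ∈ X)
    (hac : s(a, c) ∈ X) (htc : s(t, c) ∈ X) (had : s(a, d) ∈ X) (htd : s(t, d) ∈ X) (hcd : c ≠ d)
    (hY : Y.card ≤ 6) (hw : s(w, w') ∈ Y) (hwa : side w ≠ side a) (hn : s(c, n) ∈ Y) :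
    Draws X Y := by
  refine draws_of_spine hat hac htc had htd hcd (fun hpos u v P hl => ?_) fun hpos h1 h2 => ?_
  · have hs := hpos.side_left hac
    by_cases hu : side u = side a
    · refine card_inter_le_of_list (l := [s(w, w')]) (by simp) ?_ (by simpa using hY)
      simp only [List.mem_singleton, forall_eq]
      exact ⟨hw, fun h => hwa ((hl.side_of_mem h (by simp)).trans hu)⟩
    · refine card_inter_le_of_list (l := [s(c, n)]) (by simp) ?_ (by simpa using hY)
      simp only [List.mem_singleton, forall_eq]
      exact ⟨hn, fun h => hu ((hl.side_of_mem h (x := c) (by simp)).symm.trans hs)⟩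
  · obtain ⟨p, q, z, -, hpq, hp, hq, hz, -, hza, -, hzX, -⟩ := h1.exists_edges hpos
    obtain ⟨p', q', -, -, hpq', hp', hq', -⟩ := h2.exists_edges hpos
    -- Danger at both `a` and `t`, with the wasted edge `cn`, needs six edges in this copy, where at
    -- most five exist.
    have := length_le_of_side (l := [(c, n), (a, p), (a, q), (p, z), (t, p'), (t, q')])
      hpos hY hw hwa ?_ ?_
    · simp at this
    · clear hwa h1 h2
      obtain ⟨sX, sY, hd, nX, nY⟩ := hpos.facts
      obtain ⟨A, hA⟩ := exists_rel X
      obtain ⟨B, hB⟩ := exists_rel Y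
      simp only [hA, hB] at *
      clear hw hA hB hpos hY
      simp only [List.map_cons, List.map_nil, List.nodup_cons, List.mem_cons, List.not_mem_nil,
        or_false, not_or, Sym2.eq_iff, List.nodup_nil, not_false_eq_true, and_true]
      repeat' apply And.intro
      all_goals grind
    · simp [hn, hp, hq, hz, hp', hq', hpos.side_right hp, hpos.side_left hat, hpos.side_left hac]

/-- The final position if the opponent has blocked at `b` two of the three triangles that contain
`a` and two of `b`, `c`, `d`. -/
lemma draws_of_double_block {a b c d e w w' : ℕ ⊕ ℕ} {r : Sym2 (ℕ ⊕ ℕ)} (hab : s(a, b) ∈ X)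
    (hac : s(a, c) ∈ X) (had : s(a, d) ∈ X) (hcd : s(c, d) ∈ X) (hae : s(a, e) ∈ X)
    (hce : s(c, e) ∈ X) (hde : d ≠ e) (hbc : s(b, c) ∈ Y) (hbd : s(b, d) ∈ Y)
    (hY : Y.card ≤ 7) (hw : s(w, w') ∈ Y) (hwa : side w ≠ side a) (hr : r ∈ Y)
    (hrw : r ≠ s(w, w')) (hra : a ∈ r ∨ ∃ x ∈ r, side x ≠ side a) : Draws X Y := by
  refine draws_of_spine hac had hcd hae hce hde (fun hpos u v P hl => ?_) fun hpos h1 h2 => ?_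
  · have hsb := hpos.side_left hab
    have hww := hpos.side_right hw
    have hcd' : c ≠ d := hpos.ne_of_left hcd
    have hb : ∀ x, s(w, w') ≠ s(b, x) := by
      intro x h
      rcases Sym2.eq_iff.1 h with ⟨rfl, -⟩ | ⟨-, rfl⟩
      · exact hwa hsb
      · exact hwa (hww.symm.trans hsb)
    by_cases hu : side u = side a
    · have hwK : s(w, w') ∉ bookEdges u v P := fun h => hwa ((hl.side_of_mem h (by simp)).trans hu)
      obtain ⟨g, hg, hgY, hgw⟩ : ∃ g, g ∉ bookEdges u v P ∧ g ∈ Y ∧ s(w, w') ≠ g := by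
        -- If `bc`, `bd` and `r` all lay in the book, the `X`-edges `ab` and `cd` would make `b` and
        -- `c` pages, although `bc` is a book edge.
        by_contra! hcon
        have k1 : s(b, c) ∈ bookEdges u v P := by
          by_contra h
          exact hb c (hcon _ h hbc)
        have k2 : s(b, d) ∈ bookEdges u v P := by
          by_contra h
          exact hb d (hcon _ h hbd)
        have k3 : r ∈ bookEdges u v P := by
          by_contra h
          exact hrw (hcon _ h hr).symm
        have har : a ∈ r := hra.resolve_right fun ⟨x, hx, hxa⟩ =>
          hxa ((hl.side_of_mem k3 hx).trans hu)
        have va := LiveBook.mem_or_of_mem k3 har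
        have vb := LiveBook.mem_or_of_mem k1 (x := b) (by simp)
        have vc := LiveBook.mem_or_of_mem k1 (x := c) (by simp)
        have vd := LiveBook.mem_or_of_mem k2 (x := d) (by simp)
        exact hl.not_pages k1 ⟨(hl.pages_of_mem hab (hpos.ne_of_left hab) va vb).2,
          (hl.pages_of_mem hcd hcd' vc vd).1⟩
      refine card_inter_le_of_list (l := [s(w, w'), g]) (by simpa using hgw) ?_ (by simpa using hY)
      simp [hw, hwK, hg, hgY]
    · have hbK : ∀ x, s(b, x) ∉ bookEdges u v P := fun x h =>
        hu ((hl.side_of_mem h (by simp)).symm.trans hsb)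
      refine card_inter_le_of_list (l := [s(b, c), s(b, d)]) ?_ ?_ (by simpa using hY)
      · simp only [List.nodup_cons, List.mem_singleton, List.not_mem_nil, not_false_eq_true,
          List.nodup_nil, and_true]
        exact fun h => hcd' (Sym2.congr_right.1 h)
      · simp [hbc, hbd, hbK]
  · obtain ⟨p, q, z, -, hpq, hp, hq, hz, -, hza, -, hzX, -⟩ := h1.exists_edges hpos
    obtain ⟨p', q', z₁, z₂, hpq', hp', hq', hz₁, hz₂, hzc₁, hzc₂, hzX₁, hzX₂⟩ :=
      h2.exists_edges hpos
    -- Danger at `c` may use the edge `cb`, which is already counted; its continuation from `b` then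
    -- supplies the second new edge.
    obtain ⟨x₁, y₁, x₂, y₂, hx, hx₁, hx₂⟩ : ∃ x₁ y₁ x₂ y₂,
        ((x₁ = c ∧ x₂ = c ∧ y₁ ≠ y₂ ∧ y₁ ≠ b ∧ y₂ ≠ b) ∨
          (x₁ = c ∧ y₁ ≠ b ∧ x₂ = b ∧ y₂ ≠ c ∧ s(c, y₂) ∉ X)) ∧
        s(x₁, y₁) ∈ Y ∧ s(x₂, y₂) ∈ Y := by
      by_cases hpb : p' = b
      · subst hpb
        exact ⟨c, q', p', z₁, .inr ⟨rfl, hpq'.symm, rfl, hzc₁, hzX₁⟩, hq', hz₁⟩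
      by_cases hqb : q' = b
      · subst hqb
        exact ⟨c, p', q', z₂, .inr ⟨rfl, hpq', rfl, hzc₂, hzX₂⟩, hp', hz₂⟩
      · exact ⟨c, p', c, q', .inl ⟨rfl, rfl, hpq', hpb, hqb⟩, hp', hq'⟩
    have := length_le_of_side (l := [(b, c), (b, d), (a, p), (a, q), (p, z), (x₁, y₁), (x₂, y₂)])
      hpos hY hw hwa ?_ ?_
    · simp at this
    · clear hwa h1 h2 hp' hq' hz₁ hz₂ hzc₁ hzc₂ hzX₁ hzX₂ hpq' hrw hra
      obtain ⟨sX, sY, hd, nX, nY⟩ := hpos.facts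
      obtain ⟨A, hA⟩ := exists_rel X
      obtain ⟨B, hB⟩ := exists_rel Y
      simp only [hA, hB] at *
      clear hw hr hA hB hpos hY
      simp only [List.map_cons, List.map_nil, List.nodup_cons, List.mem_cons, List.not_mem_nil,
        or_false, not_or, Sym2.eq_iff, List.nodup_nil, not_false_eq_true, and_true]
      repeat' apply And.intro
      all_goals grind
    · have hsc := hpos.side_left hac
      have hsb := hpos.side_left hab
      have k1 : side x₁ = side a := by rcases hx with h | h <;> simp [h, hsc]
      have k2 : side x₂ = side a := by rcases hx with h | h <;> simp [h, hsc, hsb]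
      simp [hbc, hbd, hp, hq, hz, hpos.side_right hp, hsb, k1, k2, hx₁, hx₂]

lemma ne_of_side {x y w w' a : ℕ ⊕ ℕ} (hpos : IsPosition X Y) (hw : s(w, w') ∈ Y)
    (hwa : side w ≠ side a) (hx : side x = side a) : s(w, w') ≠ s(x, y) := by
  intro h
  rcases Sym2.eq_iff.1 h with ⟨rfl, -⟩ | ⟨-, rfl⟩
  · exact hwa hx
  · exact hwa ((hpos.side_right hw).symm.trans hx)

/-- No three of `g₁`, …, `g₄` lie together in `K`, so two of them are outside, as is `g₀`: at most 8
− 3 = 5 edges remain. -/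
lemma card_inter_le_of_four {α : Type*} [DecidableEq α] {K Y : Finset α} {g₀ g₁ g₂ g₃ g₄ : α}
    (hl : [g₀, g₁, g₂, g₃, g₄].Nodup) (hY : ∀ g ∈ [g₀, g₁, g₂, g₃, g₄], g ∈ Y)
    (h₀ : g₀ ∉ K) (h₁ : g₁ ∈ K → g₂ ∈ K → g₃ ∉ K) (h₂ : g₁ ∈ K → g₂ ∈ K → g₄ ∉ K)
    (h₃ : g₁ ∈ K → g₃ ∈ K → g₄ ∉ K) (h₄ : g₂ ∈ K → g₃ ∈ K → g₄ ∉ K) (hn : Y.card ≤ 8) :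
    (K ∩ Y).card ≤ 5 := by
  obtain ⟨g, g', hg, hg', hgY, hgY', hgg, h0g, h0g'⟩ : ∃ g g', g ∉ K ∧ g' ∉ K ∧ g ∈ Y ∧ g' ∈ Y ∧
      g ≠ g' ∧ g₀ ≠ g ∧ g₀ ≠ g' := by
    simp only [List.nodup_cons, List.mem_cons, List.not_mem_nil, or_false, not_or] at hl
    by_cases k₁ : g₁ ∈ K <;> by_cases k₂ : g₂ ∈ K <;> by_cases k₃ : g₃ ∈ K <;> grind
  exact card_inter_le_of_list (l := [g₀, g, g']) (by simp [*])
    (by simp [hY g₀ (by simp), h₀, hg, hg', hgY, hgY']) (by simpa using hn)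

/-- The final position if the opponent's edges contain the path `cbxy`. -/
lemma draws_of_path {a b c x y w w' : ℕ ⊕ ℕ} (hab : s(a, b) ∈ X) (hac : s(a, c) ∈ X)
    (hax : s(a, x) ∈ X) (hcx : s(c, x) ∈ X) (hcy : s(c, y) ∈ X) (hay : s(a, y) ∈ X)
    (hbc : s(b, c) ∈ Y) (hbx : s(b, x) ∈ Y) (hxy : s(x, y) ∈ Y) (hY : Y.card ≤ 7)
    (hw : s(w, w') ∈ Y) (hwa : side w ≠ side a) : Draws X Y := by
  intro hpos
  refine draws_of_spine hac hax hcx hay hcy (hpos.ne_of_right hxy) (fun hpos u v P hl => ?_)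
    (fun hpos h1 h2 => ?_) hpos
  · have hsb := hpos.side_left hab
    have hcx' := hpos.ne_of_left hcx
    by_cases hu : side u = side a
    · have hwK : s(w, w') ∉ bookEdges u v P := fun h => hwa ((hl.side_of_mem h (by simp)).trans hu)
      obtain ⟨g, hg, hgY, hgw⟩ : ∃ g, g ∉ bookEdges u v P ∧ g ∈ Y ∧ s(w, w') ≠ g := by
        by_contra! hcon
        have k1 : s(b, c) ∈ bookEdges u v P := by
          by_contra h
          exact ne_of_side hpos hw hwa hsb (hcon _ h hbc)
        have k2 : s(x, y) ∈ bookEdges u v P := by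
          by_contra h
          exact ne_of_side hpos hw hwa (hpos.side_left hax) (hcon _ h hxy)
        have vc := LiveBook.mem_or_of_mem k1 (x := c) (by simp)
        have vx := LiveBook.mem_or_of_mem k2 (x := x) (by simp)
        have vy := LiveBook.mem_or_of_mem k2 (x := y) (by simp)
        exact hl.not_pages k2 ⟨(hl.pages_of_mem hcx hcx' vc vx).2,
          (hl.pages_of_mem hcy (hpos.ne_of_left hcy) vc vy).2⟩
      refine card_inter_le_of_list (l := [s(w, w'), g]) (by simpa using hgw) ?_ (by simpa using hY)
      simp [hw, hwK, hg, hgY]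
    · have hbK : ∀ x, s(b, x) ∉ bookEdges u v P := fun x h =>
        hu ((hl.side_of_mem h (by simp)).symm.trans hsb)
      refine card_inter_le_of_list (l := [s(b, c), s(b, x)]) ?_ ?_ (by simpa using hY)
      · simp only [List.nodup_cons, List.mem_singleton, List.not_mem_nil, not_false_eq_true,
          List.nodup_nil, and_true]
        exact fun h => hcx' (Sym2.congr_right.1 h)
      · simp [hbc, hbx, hbK]
  · obtain ⟨p, q, z, -, hpq, hp, hq, hz, -, hza, -, hzX, -⟩ := h1.exists_edges hpos
    obtain ⟨p', q', -, -, hpq', hp', hq', -⟩ := h2.exists_edges hpos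
    obtain ⟨r, hr, hrb⟩ : ∃ r, s(c, r) ∈ Y ∧ r ≠ b := by
      by_cases hpb : p' = b
      · exact ⟨q', hq', fun h => hpq' (hpb.trans h.symm)⟩
      · exact ⟨p', hp', hpb⟩
    have := length_le_of_side (l := [(b, c), (b, x), (x, y), (a, p), (a, q), (p, z), (c, r)])
      hpos hY hw hwa ?_ ?_
    · simp at this
    · clear hwa h1 h2 hp' hq' hpq'
      obtain ⟨sX, sY, hd, nX, nY⟩ := hpos.facts
      obtain ⟨A, hA⟩ := exists_rel X
      obtain ⟨B, hB⟩ := exists_rel Y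
      simp only [hA, hB] at *
      clear hw hA hB hpos hY
      simp only [List.map_cons, List.map_nil, List.nodup_cons, List.mem_cons, List.not_mem_nil,
        or_false, not_or, Sym2.eq_iff, List.nodup_nil, not_false_eq_true, and_true]
      repeat' apply And.intro
      all_goals grind
    · simp [hbc, hbx, hxy, hp, hq, hz, hr, hpos.side_right hp, hpos.side_left hab,
        hpos.side_left hac, hpos.side_left hax]

/-- Among any three of the path edges `bc`, `bx`, `xy`, `ay`, one would join two pages, because the
edges of `X` between path vertices force its ends to be pages. In the other copy the first three
path edges are lost to the book. -/
lemma card_inter_le_of_long_path {a b c x y w w' : ℕ ⊕ ℕ} (hab : s(a, b) ∈ X) (hac : s(a, c) ∈ X)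
    (hax : s(a, x) ∈ X) (hcx : s(c, x) ∈ X) (hcy : s(c, y) ∈ X) (hbc : s(b, c) ∈ Y)
    (hbx : s(b, x) ∈ Y) (hxy : s(x, y) ∈ Y) (hay : s(a, y) ∈ Y) (hY : Y.card ≤ 8)
    (hw : s(w, w') ∈ Y) (hwa : side w ≠ side a) (hpos : IsPosition X Y) {u v : ℕ ⊕ ℕ}
    {P : Finset (ℕ ⊕ ℕ)} (hl : LiveBook X u v P) : (bookEdges u v P ∩ Y).card ≤ 5 := by
  have hsb := hpos.side_left hab
  have hsc := hpos.side_left hac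
  have hsx := hpos.side_left hax
  have hcx' := hpos.ne_of_left hcx
  have hnd : [s(w, w'), s(b, c), s(b, x), s(x, y), s(a, y)].Nodup := by
    obtain ⟨sX, sY, hd, nX, nY⟩ := hpos.facts
    have n1 := ne_of_side (y := c) hpos hw hwa hsb
    have n2 := ne_of_side (y := x) hpos hw hwa hsb
    have n3 := ne_of_side (y := y) hpos hw hwa hsx
    have n4 := ne_of_side (y := y) hpos hw hwa (x := a) rfl
    simp only [List.nodup_cons, List.mem_cons, List.not_mem_nil, or_false, not_or,
      List.nodup_nil, not_false_eq_true, and_true]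
    refine ⟨⟨n1, n2, n3, n4⟩, ?_⟩
    clear n1 n2 n3 n4 hw hwa hsb hsc hsx hl hpos hY
    obtain ⟨A, hA⟩ := exists_rel X
    obtain ⟨B, hB⟩ := exists_rel Y
    simp only [hA, hB] at *
    clear hA hB
    simp only [Sym2.eq_iff]
    repeat' apply And.intro
    all_goals grind
  by_cases hu : side u = side a
  · have hwK : s(w, w') ∉ bookEdges u v P := fun h => hwa ((hl.side_of_mem h (by simp)).trans hu)
    have hpg : ∀ {x y}, s(x, y) ∈ X → (x = u ∨ x = v ∨ x ∈ P) → (y = u ∨ y = v ∨ y ∈ P) →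
        x ∈ P ∧ y ∈ P := fun h h1 h2 => hl.pages_of_mem h (hpos.ne_of_left h) h1 h2
    have hmem : ∀ {x y}, s(x, y) ∈ bookEdges u v P →
        (x = u ∨ x = v ∨ x ∈ P) ∧ (y = u ∨ y = v ∨ y ∈ P) := fun h =>
      ⟨LiveBook.mem_or_of_mem h (by simp), LiveBook.mem_or_of_mem h (by simp)⟩
    refine card_inter_le_of_four hnd (by simp [*]) hwK ?_ ?_ ?_ ?_ hY
    · exact fun k1 k2 k3 => hl.not_pages k3 ⟨(hpg hcx (hmem k1).2 (hmem k2).2).2,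
        (hpg hcy (hmem k1).2 (hmem k3).2).2⟩
    · exact fun k1 k2 k4 => hl.not_pages k1 ⟨(hpg hab (hmem k4).1 (hmem k1).1).2,
        (hpg hcx (hmem k1).2 (hmem k2).2).1⟩
    · exact fun k1 k3 k4 => hl.not_pages k1 ⟨(hpg hab (hmem k4).1 (hmem k1).1).2,
        (hpg hac (hmem k4).1 (hmem k1).2).2⟩
    · exact fun k2 k3 k4 => hl.not_pages k2 ⟨(hpg hab (hmem k4).1 (hmem k2).1).2,
        (hpg hax (hmem k4).1 (hmem k2).2).2⟩
  · have hout : ∀ {x y}, side x = side a → s(x, y) ∉ bookEdges u v P := fun hx h =>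
      hu ((hl.side_of_mem h (by simp)).symm.trans hx)
    refine card_inter_le_of_list (l := [s(b, c), s(b, x), s(x, y)]) ?_ ?_ (by simpa using hY)
    · exact (List.nodup_cons.1 hnd).2.sublist (by simp)
    · simp [hbc, hbx, hxy, hout hsb, hout hsx]

/-- The two diagonals `by` and `cx` of the four-cycle belong to `X`. Three cycle edges meet all four
vertices, which would all be pages. -/
lemma card_inter_le_of_cycle {a b c x y w w' : ℕ ⊕ ℕ} (hab : s(a, b) ∈ X) (hac : s(a, c) ∈ X)
    (hax : s(a, x) ∈ X) (hcx : s(c, x) ∈ X) (hby : s(b, y) ∈ X) (hbc : s(b, c) ∈ Y)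
    (hbx : s(b, x) ∈ Y) (hxy : s(x, y) ∈ Y) (hcy : s(c, y) ∈ Y) (hY : Y.card ≤ 8)
    (hw : s(w, w') ∈ Y) (hwa : side w ≠ side a) (hpos : IsPosition X Y) {u v : ℕ ⊕ ℕ}
    {P : Finset (ℕ ⊕ ℕ)} (hl : LiveBook X u v P) : (bookEdges u v P ∩ Y).card ≤ 5 := by
  have hsb := hpos.side_left hab
  have hsc := hpos.side_left hac
  have hsx := hpos.side_left hax
  have hcx' := hpos.ne_of_left hcx
  have hnd : [s(w, w'), s(b, c), s(b, x), s(x, y), s(c, y)].Nodup := by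
    obtain ⟨sX, sY, hd, nX, nY⟩ := hpos.facts
    have n1 := ne_of_side (y := c) hpos hw hwa hsb
    have n2 := ne_of_side (y := x) hpos hw hwa hsb
    have n3 := ne_of_side (y := y) hpos hw hwa hsx
    have n4 := ne_of_side (y := y) hpos hw hwa (x := c) hsc
    simp only [List.nodup_cons, List.mem_cons, List.not_mem_nil, or_false, not_or,
      List.nodup_nil, not_false_eq_true, and_true]
    refine ⟨⟨n1, n2, n3, n4⟩, ?_⟩
    clear n1 n2 n3 n4 hw hwa hsb hsc hsx hl hpos hY
    obtain ⟨A, hA⟩ := exists_rel X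
    obtain ⟨B, hB⟩ := exists_rel Y
    simp only [hA, hB] at *
    clear hA hB
    simp only [Sym2.eq_iff]
    repeat' apply And.intro
    all_goals grind
  by_cases hu : side u = side a
  · have hwK : s(w, w') ∉ bookEdges u v P := fun h => hwa ((hl.side_of_mem h (by simp)).trans hu)
    have hpg : ∀ {x y}, s(x, y) ∈ X → (x = u ∨ x = v ∨ x ∈ P) → (y = u ∨ y = v ∨ y ∈ P) →
        x ∈ P ∧ y ∈ P := fun h h1 h2 => hl.pages_of_mem h (hpos.ne_of_left h) h1 h2
    have hmem : ∀ {x y}, s(x, y) ∈ bookEdges u v P →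
        (x = u ∨ x = v ∨ x ∈ P) ∧ (y = u ∨ y = v ∨ y ∈ P) := fun h =>
      ⟨LiveBook.mem_or_of_mem h (by simp), LiveBook.mem_or_of_mem h (by simp)⟩
    refine card_inter_le_of_four hnd (by simp [*]) hwK ?_ ?_ ?_ ?_ hY
    · exact fun k1 k2 k3 => hl.not_pages k1 ⟨(hpg hby (hmem k1).1 (hmem k3).2).1,
        (hpg hcx (hmem k1).2 (hmem k2).2).1⟩
    · exact fun k1 k2 k4 => hl.not_pages k1 ⟨(hpg hby (hmem k1).1 (hmem k4).2).1,
        (hpg hcx (hmem k1).2 (hmem k2).2).1⟩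
    · exact fun k1 k3 k4 => hl.not_pages k1 ⟨(hpg hby (hmem k1).1 (hmem k3).2).1,
        (hpg hcx (hmem k1).2 (hmem k3).1).1⟩
    · exact fun k2 k3 k4 => hl.not_pages k2 ⟨(hpg hby (hmem k2).1 (hmem k3).2).1,
        (hpg hcx (hmem k4).1 (hmem k2).2).2⟩
  · have hout : ∀ {x y}, side x = side a → s(x, y) ∉ bookEdges u v P := fun hx h =>
      hu ((hl.side_of_mem h (by simp)).symm.trans hx)
    refine card_inter_le_of_list (l := [s(b, c), s(b, x), s(x, y)]) ?_ ?_ (by simpa using hY)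
    · exact (List.nodup_cons.1 hnd).2.sublist (by simp)
    · simp [hbc, hbx, hxy, hout hsb, hout hsx]

/-- The final position if the opponent's edges contain the path `cbxya` and the spine is `ac`. -/
lemma draws_of_long_path {a b c x y e w w' : ℕ ⊕ ℕ} (hab : s(a, b) ∈ X) (hac : s(a, c) ∈ X)
    (hax : s(a, x) ∈ X) (hcx : s(c, x) ∈ X) (hcy : s(c, y) ∈ X) (hae : s(a, e) ∈ X)
    (hce : s(c, e) ∈ X) (hxe : x ≠ e) (hbc : s(b, c) ∈ Y) (hbx : s(b, x) ∈ Y) (hxy : s(x, y) ∈ Y)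
    (hay : s(a, y) ∈ Y) (hY : Y.card ≤ 8) (hw : s(w, w') ∈ Y) (hwa : side w ≠ side a) :
    Draws X Y := by
  refine draws_of_spine hac hax hcx hae hce hxe (fun hpos u v P hl =>
    card_inter_le_of_long_path hab hac hax hcx hcy hbc hbx hxy hay hY hw hwa hpos hl)
    fun hpos h1 h2 => ?_
  obtain ⟨p, q, z, z', hpq, hp, hq, hz, hz', hza, hza', hzX, hzX'⟩ := h1.exists_edges hpos
  obtain ⟨p', q', z₁, z₂, hpq', hp', hq', hz₁, hz₂, hzc₁, hzc₂, hzX₁, hzX₂⟩ := h2.exists_edges hpos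
  -- The edge `ay` is already counted, so danger at `a` contributes a second neighbour `r`.
  obtain ⟨r, hr, hry⟩ : ∃ r, s(a, r) ∈ Y ∧ r ≠ y := by
    by_cases hpb : p = y
    · exact ⟨q, hq, fun h => hpq (hpb.trans h.symm)⟩
    · exact ⟨p, hp, hpb⟩
  obtain ⟨x₁, y₁, x₂, y₂, hx, hx₁, hx₂⟩ : ∃ x₁ y₁ x₂ y₂,
      ((x₁ = c ∧ x₂ = c ∧ y₁ ≠ y₂ ∧ y₁ ≠ b ∧ y₂ ≠ b) ∨
        (x₁ = c ∧ y₁ ≠ b ∧ x₂ = b ∧ y₂ ≠ c ∧ s(c, y₂) ∉ X)) ∧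
      s(x₁, y₁) ∈ Y ∧ s(x₂, y₂) ∈ Y := by
    by_cases hpb : p' = b
    · subst hpb
      exact ⟨c, q', p', z₁, .inr ⟨rfl, hpq'.symm, rfl, hzc₁, hzX₁⟩, hq', hz₁⟩
    by_cases hqb : q' = b
    · subst hqb
      exact ⟨c, p', q', z₂, .inr ⟨rfl, hpq', rfl, hzc₂, hzX₂⟩, hp', hz₂⟩
    · exact ⟨c, p', c, q', .inl ⟨rfl, rfl, hpq', hpb, hqb⟩, hp', hq'⟩
  have := length_le_of_side
    (l := [(b, c), (b, x), (x, y), (a, y), (a, r), (p, z), (x₁, y₁), (x₂, y₂)]) hpos hY hw hwa ?_ ?_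
  · simp at this
  · clear hwa h1 h2 hp' hq' hz₁ hz₂ hzc₁ hzc₂ hzX₁ hzX₂ hpq' hq hpq hz' hza' hzX'
    obtain ⟨sX, sY, hd, nX, nY⟩ := hpos.facts
    obtain ⟨A, hA⟩ := exists_rel X
    obtain ⟨B, hB⟩ := exists_rel Y
    simp only [hA, hB] at *
    clear hw hA hB hpos hY
    simp only [List.map_cons, List.map_nil, List.nodup_cons, List.mem_cons, List.not_mem_nil,
      or_false, not_or, Sym2.eq_iff, List.nodup_nil, not_false_eq_true, and_true]
    repeat' apply And.intro
    all_goals grind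
  · have hsc := hpos.side_left hac
    have hsb := hpos.side_left hab
    have k1 : side x₁ = side a := by rcases hx with h | h <;> simp [h, hsc]
    have k2 : side x₂ = side a := by rcases hx with h | h <;> simp [h, hsc, hsb]
    simp [hbc, hbx, hxy, hay, hr, hz, hpos.side_right hp, hsb, hpos.side_left hax, k1, k2, hx₁, hx₂]

/-- The final position if the opponent's edges contain the path `cbxya` and the edge `ce`, and the
spine is `ax`. -/
lemma draws_of_long_path_edge {a b c x y e w w' : ℕ ⊕ ℕ} (hab : s(a, b) ∈ X) (hac : s(a, c) ∈ X)
    (hax : s(a, x) ∈ X) (hcx : s(c, x) ∈ X) (hcy : s(c, y) ∈ X) (hae : s(a, e) ∈ X)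
    (hxe : s(x, e) ∈ X) (hce : s(c, e) ∈ Y) (hbc : s(b, c) ∈ Y) (hbx : s(b, x) ∈ Y)
    (hxy : s(x, y) ∈ Y) (hay : s(a, y) ∈ Y) (hY : Y.card ≤ 8) (hw : s(w, w') ∈ Y)
    (hwa : side w ≠ side a) : Draws X Y := by
  intro hpos
  refine draws_of_spine hax hac (Sym2.eq_swap ▸ hcx) hae hxe (hpos.ne_of_right hce)
    (fun hpos u v P hl =>
    card_inter_le_of_long_path hab hac hax hcx hcy hbc hbx hxy hay hY hw hwa hpos hl)
    (fun hpos h1 h2 => ?_) hpos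
  obtain ⟨p, q, z, z', hpq, hp, hq, hz, hz', hza, hza', hzX, hzX'⟩ := h1.exists_edges hpos
  obtain ⟨p', q', z₁, z₂, hpq', hp', hq', hz₁, hz₂, hzc₁, hzc₂, hzX₁, hzX₂⟩ := h2.exists_edges hpos
  obtain ⟨r, hr, hry⟩ : ∃ r, s(a, r) ∈ Y ∧ r ≠ y := by
    by_cases hpb : p = y
    · exact ⟨q, hq, fun h => hpq (hpb.trans h.symm)⟩
    · exact ⟨p, hp, hpb⟩
  obtain ⟨x₁, y₁, hx, hx₁⟩ : ∃ x₁ y₁, ((x₁ = x ∧ y₁ ≠ b ∧ y₁ ≠ y) ∨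
        (x₁ = b ∧ y₁ ≠ x ∧ s(x, y₁) ∉ X)) ∧ s(x₁, y₁) ∈ Y := by
    by_cases hpb : p' = b
    · subst hpb
      exact ⟨p', z₁, .inr ⟨rfl, hzc₁, hzX₁⟩, hz₁⟩
    by_cases hqb : q' = b
    · subst hqb
      exact ⟨q', z₂, .inr ⟨rfl, hzc₂, hzX₂⟩, hz₂⟩
    by_cases hpy : p' = y
    · exact ⟨x, q', .inl ⟨rfl, hqb, fun h => hpq' (hpy.trans h.symm)⟩, hq'⟩
    · exact ⟨x, p', .inl ⟨rfl, hpb, hpy⟩, hp'⟩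
  have := length_le_of_side
    (l := [(b, c), (b, x), (x, y), (a, y), (c, e), (a, r), (p, z), (x₁, y₁)]) hpos hY hw hwa ?_ ?_
  · simp at this
  · clear hwa h1 h2 hp' hq' hz₁ hz₂ hzc₁ hzc₂ hzX₁ hzX₂ hpq' hq hpq hz' hza' hzX'
    obtain ⟨sX, sY, hd, nX, nY⟩ := hpos.facts
    obtain ⟨A, hA⟩ := exists_rel X
    obtain ⟨B, hB⟩ := exists_rel Y
    simp only [hA, hB] at *
    clear hw hA hB hpos hY
    simp only [List.map_cons, List.map_nil, List.nodup_cons, List.mem_cons, List.not_mem_nil,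
      or_false, not_or, Sym2.eq_iff, List.nodup_nil, not_false_eq_true, and_true]
    repeat' apply And.intro
    all_goals grind
  · have hsx := hpos.side_left hax
    have hsb := hpos.side_left hab
    have k1 : side x₁ = side a := by rcases hx with h | h <;> simp [h, hsx, hsb]
    simp [hbc, hbx, hxy, hay, hce, hr, hz, hpos.side_right hp, hsb, hsx, hpos.side_left hac, k1,
      hx₁]

/-- The final position if the opponent's edges contain the four-cycle `bcyx`. -/
lemma draws_of_cycle {a b c x y e w w' : ℕ ⊕ ℕ} (hab : s(a, b) ∈ X) (hac : s(a, c) ∈ X)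
    (hax : s(a, x) ∈ X) (hcx : s(c, x) ∈ X) (hby : s(b, y) ∈ X) (hae : s(a, e) ∈ X)
    (hce : s(c, e) ∈ X) (hxe : x ≠ e) (hbc : s(b, c) ∈ Y) (hbx : s(b, x) ∈ Y) (hxy : s(x, y) ∈ Y)
    (hcy : s(c, y) ∈ Y) (hY : Y.card ≤ 8) (hw : s(w, w') ∈ Y) (hwa : side w ≠ side a) :
    Draws X Y := by
  refine draws_of_spine hac hax hcx hae hce hxe (fun hpos u v P hl =>
    card_inter_le_of_cycle hab hac hax hcx hby hbc hbx hxy hcy hY hw hwa hpos hl)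
    fun hpos h1 h2 => ?_
  obtain ⟨p, q, z, -, hpq, hp, hq, hz, -, hza, -, hzX, -⟩ := h1.exists_edges hpos
  obtain ⟨p', q', z₁, z₂, hpq', hp', hq', hz₁, hz₂, hzc₁, hzc₂, hzX₁, hzX₂⟩ := h2.exists_edges hpos
  obtain ⟨x₁, y₁, hx, hx₁⟩ : ∃ x₁ y₁, ((x₁ = c ∧ y₁ ≠ b ∧ y₁ ≠ y) ∨
        (x₁ = b ∧ y₁ ≠ c ∧ s(c, y₁) ∉ X)) ∧ s(x₁, y₁) ∈ Y := by
    by_cases hpb : p' = b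
    · subst hpb
      exact ⟨p', z₁, .inr ⟨rfl, hzc₁, hzX₁⟩, hz₁⟩
    by_cases hqb : q' = b
    · subst hqb
      exact ⟨q', z₂, .inr ⟨rfl, hzc₂, hzX₂⟩, hz₂⟩
    by_cases hpy : p' = y
    · exact ⟨c, q', .inl ⟨rfl, hqb, fun h => hpq' (hpy.trans h.symm)⟩, hq'⟩
    · exact ⟨c, p', .inl ⟨rfl, hpb, hpy⟩, hp'⟩
  have := length_le_of_side
    (l := [(b, c), (b, x), (x, y), (c, y), (a, p), (a, q), (p, z), (x₁, y₁)]) hpos hY hw hwa ?_ ?_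
  · simp at this
  · clear hwa h1 h2 hp' hq' hz₁ hz₂ hzc₁ hzc₂ hzX₁ hzX₂ hpq'
    obtain ⟨sX, sY, hd, nX, nY⟩ := hpos.facts
    obtain ⟨A, hA⟩ := exists_rel X
    obtain ⟨B, hB⟩ := exists_rel Y
    simp only [hA, hB] at *
    clear hw hA hB hpos hY
    simp only [List.map_cons, List.map_nil, List.nodup_cons, List.mem_cons, List.not_mem_nil,
      or_false, not_or, Sym2.eq_iff, List.nodup_nil, not_false_eq_true, and_true]
    repeat' apply And.intro
    all_goals grind
  · have hsc := hpos.side_left hac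
    have hsb := hpos.side_left hab
    have k1 : side x₁ = side a := by rcases hx with h | h <;> simp [h, hsc, hsb]
    simp [hbc, hbx, hxy, hcy, hp, hq, hz, hpos.side_right hp, hsb, hsc, hpos.side_left hax, k1, hx₁]

end Final

/-! ### The opening: reaching two triangles on a common spine -/

section Opening

variable {X Y : Finset (Sym2 (ℕ ⊕ ℕ))}

/-- It suffices to have an answer to every reply to the edge `xy`. -/
lemma draws_of_move {x y : ℕ ⊕ ℕ} {n : ℕ} (hY : Y.card ≤ n) (hn : n ≤ 8)
    (hxy : x ≠ y) (hside : side x = side y) (hX : s(x, y) ∉ X) (hXY : s(x, y) ∉ Y)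
    (h : ∀ f, IsPosition (insert s(x, y) X) (insert f Y) → (insert f Y).card ≤ n + 1 →
      Draws (insert s(x, y) X) (insert f Y)) : Draws X Y :=
  draws_step (hY.trans hn) (fun _ => ⟨mem_board.2 ⟨hxy, hside⟩, hX, hXY⟩) fun f hf _ =>
    h f hf ((Finset.card_insert_le _ _).trans (Nat.succ_le_succ hY))

/-- The edge `ad` to a fresh vertex `d` is available, and the reply touches `d` at most once. -/
lemma draws_of_fresh_move (a : ℕ ⊕ ℕ) (A : Finset (ℕ ⊕ ℕ)) {n : ℕ}
    (hY : Y.card ≤ n) (hn : n ≤ 8)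
    (h : ∀ d, d ∉ A → side d = side a → (∀ x, s(x, d) ∉ X) → (∀ g ∈ Y, d ∉ g) →
      ∀ f, IsPosition (insert s(a, d) X) (insert f Y) → (insert f Y).card ≤ n + 1 →
      (∀ x y, s(x, d) ∈ insert f Y → s(y, d) ∈ insert f Y → x = y) →
      Draws (insert s(a, d) X) (insert f Y)) : Draws X Y := by
  obtain ⟨d, hd, hdA, hdXY⟩ := exists_fresh (side a) (insert a A) (X ∪ Y)
  simp only [Finset.mem_insert, not_or, Finset.mem_union] at hdA hdXY
  have hdX : ∀ x, s(x, d) ∉ X := fun x h => hdXY _ (.inl h) (by simp)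
  have hdY : ∀ x, s(x, d) ∉ Y := fun x h => hdXY _ (.inr h) (by simp)
  refine draws_of_move hY hn (Ne.symm hdA.1) hd.symm (hdX a) (hdY a) fun f hf hc =>
    h d hdA.2 hd hdX (fun g hg => hdXY g (.inr hg)) f hf hc fun x y hx hy => ?_
  have hx' := (Finset.mem_insert.1 hx).resolve_right (hdY x)
  have hy' := (Finset.mem_insert.1 hy).resolve_right (hdY y)
  exact Sym2.congr_left.1 (hx'.trans hy'.symm)

lemma swap_mem {S : Finset (Sym2 (ℕ ⊕ ℕ))} {x y : ℕ ⊕ ℕ} (h : s(x, y) ∈ S) : s(y, x) ∈ S :=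
  Sym2.eq_swap ▸ h

/-- Two triangles at a common edge `ac`, if the opponent has at most one edge at `c`. -/
lemma draws_of_untouched_page {a b c d w w' : ℕ ⊕ ℕ} {f : Sym2 (ℕ ⊕ ℕ)} (hab : s(a, b) ∈ X)
    (hac : s(a, c) ∈ X) (hcb : s(c, b) ∈ X) (had : s(a, d) ∈ X) (hcd : s(c, d) ∈ X) (hbd : b ≠ d)
    (hY : (insert f Y).card ≤ 6) (hw : s(w, w') ∈ Y) (hwa : side w ≠ side a)
    (hc : ∀ n, s(c, n) ∉ Y) : Draws X (insert f Y) := by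
  intro hpos
  have hsc := hpos.side_left hac
  -- An edge of the opponent in this copy limits books in the other copy to five edges. Without one,
  -- all six edges lie in the other copy and the race lemma applies.
  by_cases hr : ∃ g ∈ insert f Y, ∃ x ∈ g, side x = side a
  · obtain ⟨g, hg, x, hx, hxa⟩ := hr
    refine draws_of_spine hac hab hcb had hcd hbd (fun hpos u v P hl => ?_) (fun hpos h1 h2 => ?_)
      hpos
    · by_cases hu : side u = side a
      · refine card_inter_le_of_list (l := [s(w, w')]) (by simp) ?_ (by simpa using hY)
        simp only [List.mem_singleton, forall_eq]
        exact ⟨Finset.mem_insert_of_mem hw, fun h => hwa ((hl.side_of_mem h (by simp)).trans hu)⟩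
      · refine card_inter_le_of_list (l := [g]) (by simp) ?_ (by simpa using hY)
        simp only [List.mem_singleton, forall_eq]
        exact ⟨hg, fun h => hu ((hl.side_of_mem h hx).symm.trans hxa)⟩
    · obtain ⟨p, q, -, -, hpq, hp, hq, -⟩ := h2.exists_edges hpos
      have hp' := (Finset.mem_insert.1 hp).resolve_right (hc p)
      have hq' := (Finset.mem_insert.1 hq).resolve_right (hc q)
      exact hpq (Sym2.congr_right.1 (hp'.trans hq'.symm))
  · push Not at hr
    refine draws_of_race (s := a) (t := c) (P := {b, d}) (R := insert f Y) (hpos.ne_of_left hac)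
      hsc.symm ?_ ?_ (Finset.card_pair hbd) ?_ hY (fun g hg => .inr hg) hr hpos
    · simp [hpos.ne_of_left hab, hpos.ne_of_left had]
    · simp [hpos.ne_of_left hcb, hpos.ne_of_left hcd]
    · intro g hg
      rcases mem_bookEdges.1 hg with rfl | ⟨p, hp, rfl⟩ | ⟨p, hp, rfl⟩
      · exact hac
      all_goals
        rcases Finset.mem_insert.1 hp with rfl | hp
        · assumption
        · rw [Finset.mem_singleton.1 hp]
          assumption

/-- An early triangle suffices. -/
lemma draws_of_triangle {a b c w w' : ℕ ⊕ ℕ} (hab : s(a, b) ∈ X) (hac : s(a, c) ∈ X)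
    (hbc : s(b, c) ∈ X) (hY : Y.card ≤ 4) (hw : s(w, w') ∈ Y) (hwa : side w ≠ side a) :
    Draws X Y := by
  refine draws_of_fresh_move a {b, c} hY (by simp) (fun d hd hda hdX hdY f hpos hY hd1 => ?_)
  simp only [Finset.mem_insert, Finset.mem_singleton, not_or] at hd
  have nbc := (hpos.ne_of_left (Finset.mem_insert_of_mem hbc))
  have nab := (hpos.ne_of_left (Finset.mem_insert_of_mem hab))
  have nac := (hpos.ne_of_left (Finset.mem_insert_of_mem hac))
  have sb := (hpos.side_left (Finset.mem_insert_of_mem hab))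
  have sc := (hpos.side_left (Finset.mem_insert_of_mem hac))
  have hbd : s(b, d) ∉ insert s(a, d) X := by
    simp [hdX, nab.symm, Ne.symm hd.1]
  have hcd : s(c, d) ∉ insert s(a, d) X := by
    simp [hdX, nac.symm, Ne.symm hd.2]
  have hw' : s(w, w') ∈ insert f Y := Finset.mem_insert_of_mem hw
  -- The spine is chosen by where the opponent has played: a touched vertex is made a page, whereas
  -- an untouched `c` is put on the spine.
  by_cases hc : ∃ n, s(c, n) ∈ insert f Y
  · obtain ⟨n, hn⟩ := hc
    by_cases hbdY : s(b, d) ∈ insert f Y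
    · have hcdY : s(c, d) ∉ insert f Y := fun h => nbc (hd1 _ _ hbdY h)
      refine draws_of_move hY (by simp) (Ne.symm hd.2) (sc.trans hda.symm) hcd hcdY
        (fun f' hpos hY => ?_)
      exact draws_of_touched_page (a := a) (t := c) (c := d) (d := b) (n := b) (by simp [hac])
        (by simp) (by simp) (by simp [hab]) (by simp [swap_mem hbc]) hd.1 hY
        (Finset.mem_insert_of_mem hw') hwa (Finset.mem_insert_of_mem (swap_mem hbdY))
    · refine draws_of_move hY (by simp) (Ne.symm hd.1) (sb.trans hda.symm) hbd hbdY
        (fun f' hpos hY => ?_)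
      exact draws_of_touched_page (a := a) (t := b) (c := c) (d := d) (n := n) (by simp [hab])
        (by simp [hac]) (by simp [hbc]) (by simp) (by simp) (Ne.symm hd.2) hY
        (Finset.mem_insert_of_mem hw') hwa (Finset.mem_insert_of_mem hn)
  · push Not at hc
    refine draws_of_move hY (by simp) (Ne.symm hd.2) (sc.trans hda.symm) hcd (hc d)
        (fun f' hpos hY => ?_)
    exact draws_of_untouched_page (a := a) (b := b) (c := c) (d := d) (by simp [hab])
      (by simp [hac]) (by simp [swap_mem hbc]) (by simp) (by simp) (Ne.symm hd.1) hY hw' hwa hc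

/-- The position if the opponent has blocked at `b`. -/
lemma draws_of_block {a b c d w w' : ℕ ⊕ ℕ} {r : Sym2 (ℕ ⊕ ℕ)} (hab : s(a, b) ∈ X)
    (hac : s(a, c) ∈ X) (had : s(a, d) ∈ X) (hcd : s(c, d) ∈ X) (hbc : s(b, c) ∈ Y)
    (hbd : s(b, d) ∈ Y) (hY : Y.card ≤ 5) (hw : s(w, w') ∈ Y) (hwa : side w ≠ side a)
    (hr : r ∈ Y) (hrw : r ≠ s(w, w')) (hra : a ∈ r ∨ ∃ x ∈ r, side x ≠ side a) : Draws X Y := by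
  refine draws_of_fresh_move a {c, d} hY (by simp) (fun e he hea heX heY f hpos hY he1 => ?_)
  simp only [Finset.mem_insert, Finset.mem_singleton, not_or] at he
  have ncd := hpos.ne_of_left (Finset.mem_insert_of_mem hcd)
  have nac := (hpos.ne_of_left (Finset.mem_insert_of_mem hac))
  have nad := (hpos.ne_of_left (Finset.mem_insert_of_mem had))
  have sc := (hpos.side_left (Finset.mem_insert_of_mem hac))
  have sd := (hpos.side_left (Finset.mem_insert_of_mem had))
  by_cases hce : s(c, e) ∈ insert f Y
  · have hde : s(d, e) ∉ insert f Y := fun h => ncd (he1 _ _ hce h)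
    refine draws_of_move hY (by simp) (Ne.symm he.2) (sd.trans hea.symm)
      (by simp [heX, nad.symm, Ne.symm he.2]) hde (fun f' hpos hY => ?_)
    exact draws_of_double_block (a := a) (b := b) (c := d) (d := c) (e := e) (r := r)
      (by simp [hab]) (by simp [had]) (by simp [hac]) (by simp [swap_mem hcd]) (by simp) (by simp)
      (Ne.symm he.1) (by simp [hbd]) (by simp [hbc]) hY (by simp [hw]) hwa (by simp [hr]) hrw hra
  · refine draws_of_move hY (by simp) (Ne.symm he.1) (sc.trans hea.symm)
      (by simp [heX, nac.symm, Ne.symm he.1]) hce (fun f' hpos hY => ?_)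
    exact draws_of_double_block (a := a) (b := b) (c := c) (d := d) (e := e) (r := r)
      (by simp [hab]) (by simp [hac]) (by simp [had]) (by simp [hcd]) (by simp) (by simp)
      (Ne.symm he.2) (by simp [hbc]) (by simp [hbd]) hY (by simp [hw]) hwa (by simp [hr]) hrw hra

/-- The position if the opponent's edges contain the path `cbxy`. -/
lemma draws_of_path_opening {a b c x y w w' : ℕ ⊕ ℕ} (hab : s(a, b) ∈ X) (hac : s(a, c) ∈ X)
    (hax : s(a, x) ∈ X) (hcx : s(c, x) ∈ X) (hbc : s(b, c) ∈ Y) (hbx : s(b, x) ∈ Y)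
    (hxy : s(x, y) ∈ Y) (hy : ∀ z, s(z, y) ∉ X) (hya : y ≠ a) (hyb : y ≠ b) (hyc : y ≠ c)
    (hY : Y.card ≤ 5) (hw : s(w, w') ∈ Y) (hwa : side w ≠ side a) : Draws X Y := by
  intro hpos
  have nab := hpos.ne_of_left hab
  have nac := hpos.ne_of_left hac
  have nax := hpos.ne_of_left hax
  have ncx := hpos.ne_of_left hcx
  have nbc := hpos.ne_of_right hbc
  have nbx := hpos.ne_of_right hbx
  have nxy := hpos.ne_of_right hxy
  have sb := hpos.side_left hab
  have sc := hpos.side_left hac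
  have sx := hpos.side_left hax
  have sy := (hpos.side_right hxy).trans sx
  -- If `cy` is taken, the opponent has the four-cycle `bcyx`, and claiming its diagonal `by` makes
  -- it harmless. Otherwise `cy` is claimed, aiming at pages `x` and `y` on the spine `ac`.
  by_cases hcy : s(c, y) ∈ Y
  · have hby : s(b, y) ∉ Y := by
      intro hby
      have := length_le_of_side (l := [(b, c), (b, x), (x, y), (c, y), (b, y)]) hpos hY hw hwa
        (by simp; grind) (by simp [*])
      simp at this
    refine draws_of_move hY (by simp) hyb.symm (sb.trans sy.symm) (hy b) hby
      (fun f₁ hpos hY => ?_) hpos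
    refine draws_of_fresh_move a {b, c, x, y} hY (by simp)
      (fun e he hea heX heY f hpos hY he1 => ?_)
    obtain ⟨eb, ec, ex, ey⟩ : e ≠ b ∧ e ≠ c ∧ e ≠ x ∧ e ≠ y := by simpa using he
    -- A single reply cannot block the fresh vertex `e` from both `c` and `x`; whichever remains
    -- free becomes the second spine vertex.
    by_cases hce : s(c, e) ∈ insert f (insert f₁ Y)
    · have hxe : s(x, e) ∉ insert f (insert f₁ Y) := fun h => ncx (he1 _ _ hce h)
      refine draws_of_move hY (by simp) ex.symm (sx.trans hea.symm)
        (by simp only [Finset.mem_insert, heX, or_false]; simp [nax.symm, ex.symm]) hxe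
        (fun f' hpos hY => ?_)
      exact draws_of_cycle (a := a) (b := b) (c := x) (x := c) (y := y) (e := e) (w' := w')
        (by simp [hab]) (by simp [hax]) (by simp [hac]) (by simp [swap_mem hcx]) (by simp)
        (by simp) (by simp)
        ec.symm (by simp [hbx]) (by simp [hbc]) (by simp [hcy]) (by simp [hxy]) hY (by simp [hw])
        hwa
    · refine draws_of_move hY (by simp) ec.symm (sc.trans hea.symm)
        (by simp only [Finset.mem_insert, heX, or_false]; simp [nac.symm, ec.symm]) hce
        (fun f' hpos hY => ?_)
      exact draws_of_cycle (a := a) (b := b) (c := c) (x := x) (y := y) (e := e) (w' := w')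
        (by simp [hab]) (by simp [hac]) (by simp [hax]) (by simp [hcx]) (by simp)
        (by simp) (by simp)
        ex.symm (by simp [hbc]) (by simp [hbx]) (by simp [hxy]) (by simp [hcy]) hY (by simp [hw])
        hwa
  · refine draws_of_move hY (by simp) hyc.symm (sc.trans sy.symm) (hy c) hcy
      (fun f₁ hpos hY => ?_) hpos
    by_cases hay : s(a, y) ∈ insert f₁ Y
    · refine draws_of_fresh_move a {b, c, x, y} hY (by simp)
        (fun e he hea heX heY f hpos hY he1 => ?_)
      obtain ⟨eb, ec, ex, ey⟩ : e ≠ b ∧ e ≠ c ∧ e ≠ x ∧ e ≠ y := by simpa using he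
      by_cases hce : s(c, e) ∈ insert f (insert f₁ Y)
      · have hxe : s(x, e) ∉ insert f (insert f₁ Y) := fun h => ncx (he1 _ _ hce h)
        refine draws_of_move hY (by simp) ex.symm (sx.trans hea.symm)
          (by simp only [Finset.mem_insert, heX, or_false]; simp [nax.symm, ex.symm]) hxe
          (fun f' hpos hY => ?_)
        exact draws_of_long_path_edge (a := a) (b := b) (c := c) (x := x) (y := y) (e := e)
          (w' := w') (by simp [hab]) (by simp [hac]) (by simp [hax]) (by simp [hcx])
          (by simp) (by simp)
          (by simp) (Finset.mem_insert_of_mem hce) (by simp [hbc]) (by simp [hbx]) (by simp [hxy])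
          (Finset.mem_insert_of_mem (Finset.mem_insert_of_mem hay)) hY (by simp [hw]) hwa
      · refine draws_of_move hY (by simp) ec.symm (sc.trans hea.symm)
          (by simp only [Finset.mem_insert, heX, or_false]; simp [nac.symm, ec.symm]) hce
          (fun f' hpos hY => ?_)
        exact draws_of_long_path (a := a) (b := b) (c := c) (x := x) (y := y) (e := e)
          (w' := w') (by simp [hab]) (by simp [hac]) (by simp [hax]) (by simp [hcx])
          (by simp) (by simp)
          (by simp) ex.symm (by simp [hbc]) (by simp [hbx]) (by simp [hxy])
          (Finset.mem_insert_of_mem (Finset.mem_insert_of_mem hay)) hY (by simp [hw]) hwa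
    · refine draws_of_move hY (by simp) hya.symm sy.symm
        (by simp only [Finset.mem_insert, hy, or_false]; simp [nac, hya.symm]) hay
        (fun f' hpos hY => ?_)
      exact draws_of_path (a := a) (b := b) (c := c) (x := x) (y := y) (w' := w')
        (by simp [hab]) (by simp [hac]) (by simp [hax]) (by simp [hcx]) (by simp) (by simp)
        (by simp [hbc]) (by simp [hbx]) (by simp [hxy]) hY (by simp [hw]) hwa

/-- Three edges at `a`, of which the opponent has blocked one triangle. -/
lemma draws_of_three_edges {a b c d w w' : ℕ ⊕ ℕ} (hab : s(a, b) ∈ X) (hac : s(a, c) ∈ X)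
    (had : s(a, d) ∈ X) (hbc : s(b, c) ∈ Y) (hbd : s(b, d) ∉ X) (hcd : s(c, d) ∉ X) (nbd : b ≠ d)
    (ncd : c ≠ d) (hd : s(b, d) ∈ Y → s(c, d) ∉ Y) (hY : Y.card ≤ 4) (hw : s(w, w') ∈ Y)
    (hwa : side w ≠ side a)
    (h1 : ∀ f, s(b, d) ∈ insert f Y → (insert f Y).card ≤ 5 →
      Draws (insert s(c, d) X) (insert f Y))
    (h2 : ∀ f, s(c, d) ∈ insert f Y → (insert f Y).card ≤ 5 →
      Draws (insert s(b, d) X) (insert f Y)) : Draws X Y := by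
  intro hpos
  have nbc := hpos.ne_of_right hbc
  have sb := hpos.side_left hab
  have sc := hpos.side_left hac
  have sd := hpos.side_left had
  by_cases hcdY : s(c, d) ∈ Y
  · exact draws_of_move hY (by simp) nbd (sb.trans sd.symm) hbd (fun h => hd h hcdY)
      (fun f _ hY => h2 f (Finset.mem_insert_of_mem hcdY) hY) hpos
  refine draws_of_move hY (by simp) ncd (sc.trans sd.symm) hcd hcdY (fun f _ hY => ?_) hpos
  by_cases hbdY : s(b, d) ∈ insert f Y
  · exact h1 f hbdY hY
  · refine draws_of_move hY (by simp) nbd (sb.trans sd.symm) (by simp [hbd, nbc, nbd]) hbdY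
      fun f' _ hY => ?_
    exact draws_of_touched_page (a := a) (t := d) (c := b) (d := c) (n := c) (w' := w')
      (by simp [had]) (by simp [hab]) (swap_mem (by simp)) (by simp [hac]) (swap_mem (by simp))
      nbc hY (by simp [hw]) hwa (by simp [hbc])

/-- The opponent's second edge `xy` is disjoint from our first edge `ab`. -/
lemma draws_of_disjoint_edge {a b c x y w w' : ℕ ⊕ ℕ} (nxb : x ≠ b) (nxc : x ≠ c) (nxa : x ≠ a)
    (nya : y ≠ a) (nyb : y ≠ b) (nyc : y ≠ c) (sx : side x = side a) (hwa : side w ≠ side a)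
    (hpos : IsPosition {s(a, c), s(a, b)} {s(b, c), s(x, y), s(w, w')})
    (hY : ({s(b, c), s(x, y), s(w, w')} : Finset (Sym2 (ℕ ⊕ ℕ))).card ≤ 3) :
    Draws {s(a, c), s(a, b)} {s(b, c), s(x, y), s(w, w')} := by
  have nab := hpos.ne_of_left (x := a) (y := b) (by simp)
  have nac := hpos.ne_of_left (x := a) (y := c) (by simp)
  have nbc := hpos.ne_of_right (x := b) (y := c) (by simp)
  have nxy := hpos.ne_of_right (x := x) (y := y) (by simp)
  have hax : s(a, x) ∉ ({s(b, c), s(x, y), s(w, w')} : Finset _) := by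
    have := ne_of_side (y := x) hpos (w := w) (w' := w') (by simp) hwa (x := a) rfl
    simp [nab, nac, nxa.symm, nya.symm, this.symm]
  -- Joining `a` to an end of the opponent's edge `xy` means that a later block `bx` or `cx` only
  -- extends a path of the opponent, `cbxy` or `bcxy`.
  refine draws_of_move hY (by simp) nxa.symm sx.symm (by simp [nxa, nxb, nxc]) hax
    (fun f hpos hY => ?_)
  have hX : s(b, x) ∉ ({s(a, x), s(a, c), s(a, b)} : Finset _) ∧
      s(c, x) ∉ ({s(a, x), s(a, c), s(a, b)} : Finset _) := by
    simp [nab.symm, nac.symm, nxa, nxb, nxc]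
  have hy : ∀ z, s(z, y) ∉ ({s(a, x), s(a, c), s(a, b)} : Finset _) := by
    simp [nya, nyb, nyc, nxy.symm]
  refine draws_of_three_edges (a := a) (b := b) (c := c) (d := x) (w := w) (w' := w') (by simp)
    (by simp) (by simp) (by simp) hX.1 hX.2 nxb.symm nxc.symm (fun h h' => ?_) hY (by simp) hwa
    (fun f' hbx hY => ?_) (fun f' hcx hY => ?_)
  · have sb := hpos.side_left (x := a) (y := b) (by simp)
    have sc := hpos.side_left (x := a) (y := c) (by simp)
    have := length_le_of_side (l := [(b, c), (b, x), (c, x), (x, y)]) hpos hY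
      (w := w) (w' := w') (by simp) hwa ?_ ?_
    · simp at this
    · simp [nbc, nbc.symm, nxc, nxb.symm, nxc.symm, nyb.symm, nyc.symm]
    · intro q hq
      simp only [List.mem_cons, List.not_mem_nil, or_false] at hq
      rcases hq with rfl | rfl | rfl | rfl
      exacts [⟨by simp, sb⟩, ⟨h, sb⟩, ⟨h', sc⟩, ⟨by simp, sx⟩]
  · exact draws_of_path_opening (a := a) (b := b) (c := c) (x := x) (y := y) (w' := w') (by simp)
      (by simp) (by simp) (by simp) (by simp) hbx (by simp)
      (fun z => by simpa [nyc, nxy.symm] using hy z) nya nyb nyc hY (by simp) hwa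
  · exact draws_of_path_opening (a := a) (b := c) (c := b) (x := x) (y := y) (w' := w') (by simp)
      (by simp) (by simp) (by simp) (swap_mem (by simp)) hcx (by simp)
      (fun z => by simpa [nyb, nxy.symm] using hy z) nya nyc nyb hY (by simp) hwa

lemma draws_of_first_edge {a b w w' : ℕ ⊕ ℕ} {r : Sym2 (ℕ ⊕ ℕ)} (hrw : r ≠ s(w, w'))
    (hwa : side w ≠ side a) (hr : a ∈ r ∨ b ∉ r) : Draws {s(a, b)} {r, s(w, w')} := by
  intro hpos
  have hsr : ∀ {u}, u ∈ r → ∀ {v}, v ∈ r → side u = side v := by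
    intro u hu v hv
    have hrB := hpos.right r (by simp)
    induction r with | _ x y
    have := (mem_board.1 hrB).2
    rcases Sym2.mem_iff.1 hu with rfl | rfl <;> rcases Sym2.mem_iff.1 hv with rfl | rfl <;>
      simp [this]
  have nab := hpos.ne_of_left (x := a) (y := b) (by simp)
  have sb := hpos.side_left (x := a) (y := b) (by simp)
  have sw := hpos.side_right (x := w) (y := w') (by simp)
  refine draws_of_fresh_move a {b} (Finset.card_le_two) (by simp)
    (fun c hc hca hcX hcY f hpos hY hc1 => ?_) hpos
  simp only [Finset.mem_singleton] at hc
  have hcr : c ∉ r := hcY r (by simp)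
  have nac := hpos.ne_of_left (x := a) (y := c) (by simp)
  by_cases hbc : s(b, c) ∈ insert f ({r, s(w, w')} : Finset _)
  swap
  · refine draws_of_move hY (by simp) (Ne.symm hc) (sb.trans hca.symm)
      (by simp [nab.symm, nac.symm]) hbc (fun f' hpos hY => ?_)
    exact draws_of_triangle (a := a) (b := b) (c := c) (w := w) (w' := w') (by simp) (by simp)
      (by simp) hY (by simp) hwa
  -- If `r` meets `a` or lies in the other copy, a fresh third edge at `a` works. Otherwise `r` is
  -- disjoint from `ab` in this copy, and one of its ends serves as the third neighbour.
  by_cases hcond : a ∈ r ∨ ∃ x ∈ r, side x ≠ side a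
  · refine draws_of_fresh_move a {b, c} hY (by simp)
      (fun d hd hda hdX hdY f' hpos hY hd1 => ?_)
    simp only [Finset.mem_insert, Finset.mem_singleton, not_or] at hd
    have nad := hpos.ne_of_left (x := a) (y := d) (by simp)
    refine draws_of_three_edges (a := a) (b := b) (c := c) (d := d) (w := w) (w' := w') (by simp)
      (by simp) (by simp) (Finset.mem_insert_of_mem hbc) ?_ ?_ (Ne.symm hd.1) (Ne.symm hd.2)
      (fun h h' => hc (hd1 _ _ h' h)) hY (by simp) hwa (fun f'' hbd hY => ?_) (fun f'' hcd hY => ?_)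
    · rw [Finset.mem_insert, not_or]
      exact ⟨by simp [nab.symm, nad.symm, Ne.symm hd.1], hdX b⟩
    · rw [Finset.mem_insert, not_or]
      exact ⟨by simp [nac.symm, nad.symm, Ne.symm hd.2], hdX c⟩
    · exact draws_of_block (a := a) (b := b) (c := c) (d := d) (r := r) (w := w) (w' := w')
        (by simp) (by simp) (by simp) (by simp)
        (Finset.mem_insert_of_mem (Finset.mem_insert_of_mem hbc)) hbd hY (by simp) hwa (by simp) hrw
        hcond
    · exact draws_of_block (a := a) (b := c) (c := b) (d := d) (r := r) (w := w) (w' := w')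
        (by simp) (by simp) (by simp) (by simp)
        (swap_mem (Finset.mem_insert_of_mem (Finset.mem_insert_of_mem hbc))) hcd hY (by simp) hwa
        (by simp) hrw hcond
  · push Not at hcond
    obtain ⟨har, hra⟩ := hcond
    have hbr := hr.resolve_left har
    induction r with | _ x y
    simp only [Sym2.mem_iff, not_or] at har hbr hcr
    obtain ⟨nax', nay⟩ := har
    obtain ⟨nbx, nby⟩ := hbr
    obtain ⟨ncx, ncy⟩ := hcr
    have sx := hra x (by simp)
    have sy := hra y (by simp)
    have nxy := hpos.ne_of_right (x := x) (y := y) (by simp)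
    have hbf : s(b, c) = f := (Finset.mem_insert.1 hbc).resolve_right fun h => hcY _ h (by simp)
    subst hbf
    exact draws_of_disjoint_edge (fun h => nbx h.symm) (Ne.symm ncx) (Ne.symm nax') (Ne.symm nay)
      (Ne.symm nby) (Ne.symm ncy) sx hwa hpos hY

lemma draws_of_first_move (w w' : ℕ ⊕ ℕ) : Draws ∅ {s(w, w')} := by
  obtain ⟨a, ha, -⟩ := exists_fresh (!side w) ∅ ∅
  obtain ⟨b, hb, hba, -⟩ := exists_fresh (!side w) {a} ∅
  have hwa : side w ≠ side a := by simp [ha]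
  have hwb : side w ≠ side b := by simp [hb]
  have nab : a ≠ b := fun h => hba (by simp [h])
  refine draws_step (e := s(a, b)) (by simp) (fun hpos => ⟨mem_board.2 ⟨nab, ha.trans hb.symm⟩,
    by simp, fun h => ?_⟩) fun f hpos hf => ?_
  · exact ne_of_side hpos (by simp) hwa (x := a) rfl (Finset.mem_singleton.1 h).symm
  · have hfw : f ≠ s(w, w') := fun h => hf.2.2 (by simp [h])
    rw [insert_empty_eq]
    -- The ends of the first edge are interchangeable, so a reply that touches `b` alone is treated
    -- by swapping them.
    by_cases hbf : a ∈ f ∨ b ∉ f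
    · exact draws_of_first_edge hfw hwa hbf
    · rw [not_or, not_not] at hbf
      rw [Sym2.eq_swap]
      exact draws_of_first_edge hfw hwb (.inl hbf.2)

end Opening

end RamseyGame

theorem theorem1 : RamseyGame.IsDraw (Komega ⊕g Komega) K6MinusK4 := by
  refine RamseyGame.isDraw_of_not_loses RamseyGame.board_infinite
    (fun h => RamseyGame.not_contains_of_card (Y := ∅) (by simp) (by simp) (by simpa using h))
    fun e he => ?_
  induction e with | _ w w'
  have := RamseyGame.draws_of_first_move w w' ⟨by simp, by simpa using he, by simp⟩
  simpa using this
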